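/- Let $V:\mathbb R\to\mathbb R$ be continuous with $V(x+1)=V(x)$ and consider the Gross–Pitaevskii equation $$i\psi_t=-\tfrac12\psi_{xx}+\sigma|\psi|^2\psi+V(x)\psi,$$ focusing for $\sigma=-1$ and defocusing for $\sigma=+1$. A standing wave is a classical solution $\psi(x,t)=e^{-i\omega t}\phi(x)$ with $\omega\in\mathbb R$ and $\phi\not\equiv0$ real-valued and either periodic, $\phi(x+1)=\phi(x)$, or antiperiodic, $\phi(x+1)=-\phi(x)$. Put $$L_-=-\tfrac12\partial_x^2+V+\sigma\phi^2-\omega,\qquad L_+=-\tfrac12\partial_x^2+V+3\sigma\phi^2-\omega=L_-+2\sigma\phi^2 .$$ The Bogoliubov operator is $(u,v)\mapsto(L_-v,L_+u)$ on $L^2(\mathbb R;\mathbb C)^2$ with domain $H^2(\mathbb R;\mathbb C)^2$. The wave is called modulationally unstable if every neighbourhood of $0$ in $\mathbb C$ contains a non-real point of the spectrum of this operator. For a continuous $1$-periodic real $q$ let $\Delta_q(E)$ be the trace of the period map over $[0,1]$ of $-\tfrac12y''+qy=Ey$. A real $E$ is the lower (upper) edge of a band of $-\tfrac12\partial_x^2+q$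 if $|\Delta_q(E)|=2$ and $|\Delta_q|<2$ on some interval $(E,E+\varepsilon)$ (respectively $(E-\varepsilon,E)$), $\varepsilon>0$. It is adjacent to an open gap if moreover $|\Delta_q|>2$ on some interval $(E-\varepsilon,E)$ (respectively $(E,E+\varepsilon)$). Then small-amplitude standing waves of the focusing equation corresponding to lower band edges, and small-amplitude standing waves of the defocusing equation corresponding to upper band edges, are modulationally unstable, and the spectrum of the Bogoliubov operator contains a segment $\{i\tau:|\tau|<\tau_0\}$, $\tau_0>0$, of the imaginary axis. Precisely: 1. For every $K$ there is $\delta>0$, depending only on $K$, such that if $|V|\le K$ everywhere, this conclusion holds for every focusing standing wave with $|\phi(x)|<\delta$ for all $x$ for which $0$ is the lower edge of a band of $L_-$, and for every defocusing standing wave with $|\phi(x)|<\delta$ for all $x$ for which $0$ is the upper edge of a band of $L_-$. 2. (Waves bifurcating from a band edge of the linear problem.) Let $E$ be the lower (respectively upper) edge of a band of $-\tfrac12\partial_x^2+V$, adjacent to an open gap. Then there is $\delta>0$, depending on $V$ and $E$, such that the conclusion holds for every standing wave of the focusing (respectively defocusing) equation with $|\omega-E|<\delta$ and $|\phi(x)|<\delta$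 for all $x$. -/

import Mathlib

open MeasureTheory Set


noncomputable section

namespace GP

/-- `ψ t x` is a classical solution of `i ψ_t = -½ ψ_xx + σ |ψ|² ψ + V ψ`
(`σ = -1`: focusing, `σ = 1`: defocusing). -/
def IsGPSolution (σ : ℝ) (V : ℝ → ℝ) (ψ : ℝ → ℝ → ℂ) : Prop :=
  (∀ x, Differentiable ℝ (fun t => ψ t x)) ∧
  (∀ t, ContDiff ℝ 2 (ψ t)) ∧
  ∀ t x, Complex.I * deriv (fun s => ψ s x) t =
    -(1 / 2) * iteratedDeriv 2 (ψ t) x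
      + (σ : ℂ) * ((‖ψ t x‖ ^ 2 : ℝ) : ℂ) * ψ t x + (V x : ℂ) * ψ t x

/-- `exp (-iωt) φ(x)` is a nontrivial standing wave whose real profile `φ` is periodic or
antiperiodic with period one. -/
def IsStandingWave (σ : ℝ) (V : ℝ → ℝ) (ω : ℝ) (φ : ℝ → ℝ) : Prop :=
  IsGPSolution σ V (fun t x => Complex.exp (-Complex.I * ω * t) * (φ x : ℂ)) ∧
  ((∀ x, φ (x + 1) = φ x) ∨ (∀ x, φ (x + 1) = -φ x)) ∧
  ∃ x, φ x ≠ 0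

/-- The potential of `L₋ = -½ ∂² + V + σ φ² - ω` (so that `L₋ φ = 0` for a standing wave). -/
def minusPotential (σ : ℝ) (V : ℝ → ℝ) (ω : ℝ) (φ : ℝ → ℝ) : ℝ → ℝ :=
  fun x => V x + σ * φ x ^ 2 - ω

/-- The potential of `L₊ = -½ ∂² + V + 3 σ φ² - ω = L₋ + 2 σ φ²`. -/
def plusPotential (σ : ℝ) (V : ℝ → ℝ) (ω : ℝ) (φ : ℝ → ℝ) : ℝ → ℝ :=
  fun x => V x + 3 * σ * φ x ^ 2 - ω

/-! ### Bands of a Schrödinger operator `-½ ∂² + q` with `q` of period one -/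

/-- `y` is a classical solution of `-½ y'' + q y = E y`. -/
def SolvesHill (q : ℝ → ℝ) (E : ℝ) (y : ℝ → ℝ) : Prop :=
  ContDiff ℝ 2 y ∧ ∀ x, -(1 / 2) * iteratedDeriv 2 y x + q x * y x = E * y x

/-- `D` is the trace of the period map (the Floquet discriminant) at energy `E`. For continuous `q`
there is exactly one such `D`, since the normalized solutions `c`, `s` exist and are unique. -/
def IsDiscriminant (q : ℝ → ℝ) (E D : ℝ) : Prop :=
  ∃ c s : ℝ → ℝ, SolvesHill q E c ∧ SolvesHill q E s ∧
    c 0 = 1 ∧ deriv c 0 = 0 ∧ s 0 = 0 ∧ deriv s 0 = 1 ∧ D = c 1 + deriv s 1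

/-- `E` is in the interior of a band: the discriminant is in `(-2, 2)`. -/
def InBandInterior (q : ℝ → ℝ) (E : ℝ) : Prop := ∃ D, IsDiscriminant q E D ∧ |D| < 2

/-- `E` is in a gap: the discriminant is outside `[-2, 2]`. -/
def InGap (q : ℝ → ℝ) (E : ℝ) : Prop := ∃ D, IsDiscriminant q E D ∧ 2 < |D|

/-- `E` is the lower edge of a band. (It may also be the upper edge of the preceding band, if the
gap between the two is closed.) -/
def IsLowerBandEdge (q : ℝ → ℝ) (E : ℝ) : Prop :=
  (∃ D, IsDiscriminant q E D ∧ |D| = 2) ∧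
  ∃ ε > 0, ∀ E' ∈ Ioo E (E + ε), InBandInterior q E'

/-- `E` is the upper edge of a band. (It may also be the lower edge of the next band, if the
gap between the two is closed.) -/
def IsUpperBandEdge (q : ℝ → ℝ) (E : ℝ) : Prop :=
  (∃ D, IsDiscriminant q E D ∧ |D| = 2) ∧
  ∃ ε > 0, ∀ E' ∈ Ioo (E - ε) E, InBandInterior q E'

/-- `E` separates a gap (below) from a band (above). -/
def IsLowerBandEdgeAtGap (q : ℝ → ℝ) (E : ℝ) : Prop :=
  IsLowerBandEdge q E ∧ ∃ ε > 0, ∀ E' ∈ Ioo (E - ε) E, InGap q E'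

/-- `E` separates a band (below) from a gap (above). -/
def IsUpperBandEdgeAtGap (q : ℝ → ℝ) (E : ℝ) : Prop :=
  IsUpperBandEdge q E ∧ ∃ ε > 0, ∀ E' ∈ Ioo E (E + ε), InGap q E'

/-! ### The Bogoliubov operator on `L²(ℝ; ℂ)²` and its spectrum -/

/-- The complex space `L²(ℝ)`. -/
abbrev L2 : Type := Lp ℂ 2 (volume : Measure ℝ)

/-- `w` is the second weak derivative of `f`. -/
def IsWeakSecondDeriv (f w : L2) : Prop :=
  ∀ χ : ℝ → ℂ, ContDiff ℝ (⊤ : ℕ∞) χ → HasCompactSupport χ →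
    ∫ x, iteratedDeriv 2 χ x * f x = ∫ x, χ x * w x

/-- The graph of `-½ ∂² + q` in `L²(ℝ)` with domain `H²(ℝ)` (`q` bounded): `f` has a second weak
derivative in `L²(ℝ)` and `g = -½ f'' + q f`. -/
def SchrodingerGraph (q : ℝ → ℝ) (f g : L2) : Prop :=
  ∃ w : L2, IsWeakSecondDeriv f w ∧
    ∀ᵐ x ∂(volume : Measure ℝ), g x = -(1 / 2) * w x + (q x : ℂ) * f x

/-- The graph of the Bogoliubov operator `(u, v) ↦ (L₋ v, L₊ u)` with domain `H²(ℝ) × H²(ℝ)`. -/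
def BogoliubovGraph (σ : ℝ) (V : ℝ → ℝ) (ω : ℝ) (φ : ℝ → ℝ) (U G : L2 × L2) : Prop :=
  SchrodingerGraph (minusPotential σ V ω φ) U.2 G.1 ∧
  SchrodingerGraph (plusPotential σ V ω φ) U.1 G.2

/-- The spectrum of the Bogoliubov operator `B`: all `μ` for which `B - μ`, from the domain of `B`
to `L² × L²`, does not have a bounded everywhere defined two-sided inverse `R`.
(`BogoliubovGraph … U (F + μ • U)` says that `U` is in the domain of `B` and `(B - μ) U = F`.) -/
def bogoliubovSpectrum (σ : ℝ) (V : ℝ → ℝ) (ω : ℝ) (φ : ℝ → ℝ) : Set ℂ :=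
  {μ | ¬ ∃ R : (L2 × L2) →L[ℂ] (L2 × L2), ∀ U F : L2 × L2,
      BogoliubovGraph σ V ω φ U (F + μ • U) ↔ U = R F}

/-- Modulational instability: spectrum off the real axis in every neighbourhood of `0`. -/
def ModulationallyUnstable (σ : ℝ) (V : ℝ → ℝ) (ω : ℝ) (φ : ℝ → ℝ) : Prop :=
  ∀ ε > 0, ∃ μ ∈ bogoliubovSpectrum σ V ω φ, ‖μ‖ < ε ∧ μ.im ≠ 0

/-- The spectrum contains a segment of the imaginary axis around `0`. -/
def HasImaginaryBand (σ : ℝ) (V : ℝ → ℝ) (ω : ℝ) (φ : ℝ → ℝ) : Prop :=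
  ∃ τ₀ > 0, ∀ τ : ℝ, |τ| < τ₀ → Complex.I * τ ∈ bogoliubovSpectrum σ V ω φ

end GP

end

/-! Since `L₋ φ = 0` with `φ` periodic or antiperiodic, the period map of `L₋` at energy `0` is
parabolic: in a basis `φ`, `φ₂` of unit Wronskian it is `ε = ±1` times a Jordan block with
coefficient `c`. In the form `y'' = Q y`, passing from `L₋` to `L₊` replaces `Q` by `Q - W` with `W
= -4σφ²`, a perturbation of one sign. A small `W` with `s W ≥ 0`, positive where `φ ≠ 0`, makes the
map elliptic as soon as `s c ≥ 0`. A lower band edge gives this for `s = 1`, the focusing sign, and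
an upper edge for `s = -1`, the defocusing sign. Hence `0` is interior to a band of `L₊`.

The comparison is a Sturm argument (`IsSmallPerturbation.no_real_floquet`): along a real Floquet
solution of the perturbed equation, a projective phase relative to `φ`, `φ₂` would be monotone in
one direction, yet be shifted over a period by the Jordan block in the other. That the edge fixes
the sign of `c` is `IsParabolic.sign_nonneg`. The amplitude bound depends on `K` alone because
growth is measured by `κ²y² + y'²` with `κ²` close to `2ω` (`exists_amplitude_bound`). At an edge of
the linear problem next to an open gap, `c` is nonzero and its sign survives small perturbations
(`IsParabolic.coeff_ne_zero`, `IsParabolic.sign_stable`), so the nearby waves inherit it.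

For the spectrum at `μ = iτ`, putting `u = i p` gives the real system `v'' = Q₁ v + 2τ p`, `p'' = Q₂
p - 2τ v`. Its period map is symplectic, so its characteristic polynomial divided by `λ²` is real on
the unit circle. At `τ = 0` this function is `(2 cos x - T₁)(2 cos x - T₂)` with `|T₁| = 2` and
`|T₂| < 2`, which changes sign. The sign change persists for small `τ` and yields a unimodular
multiplier, hence a bounded solution (`exists_isBoundedCoupledSol`). Cut off at large scales, that
solution is a Weyl sequence (`mem_bogoliubovSpectrum_of_bounded`). -/

namespace GP

open scoped BoundedContinuousFunction NNReal ENNReal Topology Matrix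

/-! ### Global existence and continuous dependence for ordinary differential equations. -/

theorem abs_integral_exp_abs_le {k : ℝ} (hk : 0 < k) (t : ℝ) :
    |∫ s in (0 : ℝ)..t, Real.exp (k * |s|)| ≤ k⁻¹ * Real.exp (k * |t|) := by
  have key : ∀ t : ℝ, 0 ≤ t → ∫ s in (0 : ℝ)..t, Real.exp (k * |s|) =
      k⁻¹ * (Real.exp (k * t) - 1) := by
    intro t ht
    have h1 : ∫ s in (0 : ℝ)..t, Real.exp (k * |s|) = ∫ s in (0 : ℝ)..t, Real.exp (k * s) := by
      apply intervalIntegral.integral_congr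
      intro s hs
      rw [uIcc_of_le ht] at hs
      simp [abs_of_nonneg hs.1]
    rw [h1, intervalIntegral.integral_comp_mul_left (fun x => Real.exp x) hk.ne']
    simp
  have pos : ∀ t : ℝ, 0 ≤ t → |∫ s in (0 : ℝ)..t, Real.exp (k * |s|)| ≤
      k⁻¹ * Real.exp (k * |t|) := by
    intro t ht
    rw [key t ht, abs_of_nonneg ht, abs_of_nonneg]
    · gcongr; linarith
    · have : 1 ≤ Real.exp (k * t) := Real.one_le_exp (by positivity)
      have := inv_pos.2 hk
      nlinarith
  rcases le_total 0 t with ht | ht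
  · exact pos t ht
  · have h := pos (-t) (by linarith)
    have h2 : ∫ s in (0 : ℝ)..(-t), Real.exp (k * |s|) =
        -∫ s in (0 : ℝ)..t, Real.exp (k * |s|) := by
      have := intervalIntegral.integral_comp_neg (a := 0) (b := t)
        (fun s => Real.exp (k * |s|))
      simp only [abs_neg, neg_zero] at this
      rw [this, intervalIntegral.integral_symm]
    rwa [h2, abs_neg, abs_neg] at h

/-- Global existence for a globally Lipschitz non-autonomous ODE. -/
theorem exists_global_solution {E : Type*} [NormedAddCommGroup E] [NormedSpace ℝ E]
    [CompleteSpace E] {f : ℝ → E → E} {K : ℝ≥0} (hf : Continuous (fun p : ℝ × E => f p.1 p.2))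
    (hK : ∀ t, LipschitzWith K (f t)) (h0 : ∀ t, f t 0 = 0) (x₀ : E) :
    ∃ x : ℝ → E, x 0 = x₀ ∧ ∀ t, HasDerivAt x (f t (x t)) t := by
  -- Bielecki's weight: the unknown is `ρ w` with `w` bounded and `ρ = exp (k|t|)`. Integrating the
  -- weight gains `1/k`, so with this `k` the integral operator contracts by `1/2` on the whole line
  -- at once. The condition `f t 0 = 0` keeps images of bounded functions bounded.
  set k : ℝ := 2 * K + 2 with hk
  have hkpos : 0 < k := by positivity
  have hKk : (K : ℝ) * k⁻¹ ≤ 1 / 2 := by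
    rw [← div_eq_mul_inv, div_le_iff₀ hkpos, hk]; linarith
  let ρ : ℝ → ℝ := fun t => Real.exp (k * |t|)
  have hρ : Continuous ρ := by fun_prop
  have hρpos : ∀ t, 0 < ρ t := fun t => Real.exp_pos _
  have hρ1 : ∀ t, 1 ≤ ρ t := fun t => Real.one_le_exp (by positivity)
  have hcont : ∀ w : ℝ → E, Continuous w → Continuous (fun s => f s (ρ s • w s)) := by
    intro w hw
    exact hf.comp (continuous_id.prodMk (hρ.smul hw))
  have hbound : ∀ (w w' : ℝ → E) (c : ℝ), Continuous w → Continuous w' → (∀ t, ‖w t - w' t‖ ≤ c) →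
      ∀ t, ‖(ρ t)⁻¹ • ∫ s in (0 : ℝ)..t, (f s (ρ s • w s) - f s (ρ s • w' s))‖ ≤ 1 / 2 * c := by
    intro w w' c hw hw' hc t
    have hc0 : 0 ≤ c := (norm_nonneg _).trans (hc 0)
    have h1 : ‖∫ s in (0 : ℝ)..t, (f s (ρ s • w s) - f s (ρ s • w' s))‖ ≤
        |∫ s in (0 : ℝ)..t, K * c * ρ s| := by
      apply intervalIntegral.norm_integral_le_abs_of_norm_le
      · refine Filter.Eventually.of_forall fun s => ?_
        calc _ ≤ K * ‖ρ s • w s - ρ s • w' s‖ := (hK s).norm_sub_le _ _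
          _ = K * (ρ s * ‖w s - w' s‖) := by
            rw [← smul_sub, norm_smul, Real.norm_of_nonneg (hρpos s).le]
          _ ≤ K * (ρ s * c) := by gcongr; exact hc s
          _ = _ := by ring
      · exact (continuous_const.mul hρ).intervalIntegrable _ _
    rw [intervalIntegral.integral_const_mul, abs_mul, abs_of_nonneg (by positivity)] at h1
    have h2 := abs_integral_exp_abs_le hkpos t
    rw [norm_smul, norm_inv, Real.norm_of_nonneg (hρpos t).le, inv_mul_le_iff₀ (hρpos t)]
    calc _ ≤ _ := h1
      _ ≤ K * c * (k⁻¹ * ρ t) := by gcongr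
      _ = (K * k⁻¹) * (c * ρ t) := by ring
      _ ≤ 1 / 2 * (c * ρ t) := by gcongr
      _ = _ := by ring
  let T₀ : (ℝ → E) → ℝ → E := fun w t => (ρ t)⁻¹ • (x₀ + ∫ s in (0 : ℝ)..t, f s (ρ s • w s))
  have hTc : ∀ w : ℝ → E, Continuous w → Continuous (T₀ w) := by
    intro w hw
    refine (hρ.inv₀ fun t => (hρpos t).ne').smul (continuous_const.add ?_)
    exact intervalIntegral.continuous_primitive
      (fun a b => (hcont w hw).intervalIntegrable a b) 0
  let T : (ℝ →ᵇ E) → (ℝ →ᵇ E) := fun w =>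
    BoundedContinuousFunction.ofNormedAddCommGroup (T₀ w) (hTc w w.continuous)
      (‖x₀‖ + 1 / 2 * ‖w‖) (by
        intro t
        have h := hbound w 0 ‖w‖ w.continuous continuous_const
          (fun t => by simpa using w.norm_coe_le_norm t) t
        simp only [Pi.zero_apply, smul_zero, h0, sub_zero] at h
        simp only [T₀, smul_add]
        refine (norm_add_le _ _).trans (add_le_add ?_ h)
        rw [norm_smul, norm_inv, Real.norm_of_nonneg (hρpos t).le, inv_mul_le_iff₀ (hρpos t)]
        nlinarith [norm_nonneg x₀, hρ1 t])
  have hT : ContractingWith (1 / 2) T := by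
    refine ⟨by norm_num, LipschitzWith.of_dist_le_mul fun w w' => ?_⟩
    rw [BoundedContinuousFunction.dist_le (by positivity)]
    intro t
    have h := hbound w w' (dist w w') w.continuous w'.continuous
      (fun t => by rw [← dist_eq_norm]; exact BoundedContinuousFunction.dist_coe_le_dist t) t
    rw [intervalIntegral.integral_sub ((hcont w w.continuous).intervalIntegrable _ _)
      ((hcont w' w'.continuous).intervalIntegrable _ _)] at h
    have h3 : T w t - T w' t = (ρ t)⁻¹ • ((∫ s in (0 : ℝ)..t, f s (ρ s • w s)) -
        ∫ s in (0 : ℝ)..t, f s (ρ s • w' s)) := by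
      change T₀ w t - T₀ w' t = _
      simp only [T₀, ← smul_sub]
      congr 1
      abel
    rw [dist_eq_norm, h3]
    simpa using h
  have hfix := hT.fixedPoint_isFixedPt
  set w := hT.fixedPoint T
  have hx : ∀ t, ρ t • w t = x₀ + ∫ s in (0 : ℝ)..t, f s (ρ s • w s) := by
    intro t
    have h1 : T₀ w t = w t := DFunLike.congr_fun hfix t
    rw [← h1, smul_inv_smul₀ (hρpos t).ne']
  refine ⟨fun t => ρ t • w t, (hx 0).trans (by simp), fun t => ?_⟩
  have h1 : HasDerivAt (fun t => x₀ + ∫ s in (0 : ℝ)..t, f s (ρ s • w s)) (f t (ρ t • w t)) t :=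
    ((hcont w w.continuous).integral_hasStrictDerivAt 0 t).hasDerivAt.const_add _
  exact h1.congr_of_eventuallyEq (Filter.Eventually.of_forall hx)

/-- Continuous dependence at time one on the vector field. -/
theorem exists_close_of_vectorField_close {K : ℝ≥0} {ε : ℝ} (hε : 0 < ε) :
    ∃ η > 0, ∀ {E : Type} [NormedAddCommGroup E] [NormedSpace ℝ E] {f g : ℝ → E → E} {x y : ℝ → E},
      (∀ t, LipschitzWith K (f t)) → x 0 = y 0 → (∀ t, HasDerivAt x (f t (x t)) t) →
      (∀ t, HasDerivAt y (g t (y t)) t) → (∀ t ∈ Icc (0 : ℝ) 1, ‖f t (y t) - g t (y t)‖ ≤ η) →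
      ‖x 1 - y 1‖ < ε := by
  -- The Grönwall bound without initial error tends to `0` with the defect and involves only `K`, so
  -- one `η` serves all fields and all spaces.
  have hc := (gronwallBound_continuous_ε 0 K 1).tendsto 0
  have h0 : gronwallBound 0 K 0 1 = 0 := gronwallBound_ε0_δ0 _ _
  rw [h0] at hc
  have := (Metric.tendsto_nhds_nhds.1 hc) ε hε
  obtain ⟨η, hη, h⟩ := this
  refine ⟨η / 2, by positivity, ?_⟩
  intro E _ _ f g x y hf h0 hx hy hfg
  have h1 := dist_le_of_approx_trajectories_ODE (v := f) (K := K) (f := x) (g := y)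
    (f' := fun t => f t (x t)) (g' := fun t => g t (y t)) (a := 0) (b := 1) (δ := 0) (εf := 0)
    (εg := η / 2) hf (fun t _ => (hx t).continuousAt.continuousWithinAt)
    (fun t _ => (hx t).hasDerivWithinAt) (fun t _ => by simp)
    (fun t _ => (hy t).continuousAt.continuousWithinAt)
    (fun t _ => (hy t).hasDerivWithinAt)
    (fun t ht => by
      rw [dist_comm, dist_eq_norm]; exact hfg t ⟨ht.1, ht.2.le⟩) (by simp [h0]) 1 (by simp)
  have h2 := @h (η / 2) (by rw [Real.dist_eq, sub_zero, abs_of_pos (by positivity)]; linarith)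
  rw [Real.dist_eq, sub_zero] at h2
  rw [← dist_eq_norm]
  simp only [zero_add, sub_zero] at h1
  exact h1.trans_lt ((le_abs_self _).trans_lt h2)

/-! ### Solutions of Hill's equation. -/

/-- `y` solves `y'' = Q y`, with derivative `z`. -/
structure IsSol (Q y z : ℝ → ℝ) : Prop where
  deriv₁ : ∀ x, HasDerivAt y (z x) x
  deriv₂ : ∀ x, HasDerivAt z (Q x * y x) x

namespace IsSol

variable {Q W y z y₁ z₁ y₂ z₂ : ℝ → ℝ}

theorem continuous₁ (h : IsSol Q y z) : Continuous y :=
  continuous_iff_continuousAt.2 fun x => (h.deriv₁ x).continuousAt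

theorem continuous₂ (h : IsSol Q y z) : Continuous z :=
  continuous_iff_continuousAt.2 fun x => (h.deriv₂ x).continuousAt

theorem lincomb (h₁ : IsSol Q y₁ z₁) (h₂ : IsSol Q y₂ z₂) (a b : ℝ) :
    IsSol Q (fun x => a * y₁ x + b * y₂ x) (fun x => a * z₁ x + b * z₂ x) where
  deriv₁ x := ((h₁.deriv₁ x).const_mul a).add ((h₂.deriv₁ x).const_mul b)
  deriv₂ x := (((h₁.deriv₂ x).const_mul a).add ((h₂.deriv₂ x).const_mul b)).congr_deriv (by ring)

theorem smul (h : IsSol Q y z) (a : ℝ) : IsSol Q (fun x => a * y x) (fun x => a * z x) where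
  deriv₁ x := (h.deriv₁ x).const_mul a
  deriv₂ x := ((h.deriv₂ x).const_mul a).congr_deriv (by ring)

theorem shift (h : IsSol Q y z) (hQ : ∀ x, Q (x + 1) = Q x) :
    IsSol Q (fun x => y (x + 1)) (fun x => z (x + 1)) where
  deriv₁ x := (h.deriv₁ (x + 1)).comp_add_const x 1
  deriv₂ x := ((h.deriv₂ (x + 1)).comp_add_const x 1).congr_deriv (by rw [hQ])

end IsSol

/-- The first order vector field of `y'' = Q y`. -/
def hillField (Q : ℝ → ℝ) (t : ℝ) (p : ℝ × ℝ) : ℝ × ℝ := (p.2, Q t * p.1)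

theorem IsSol.hasDerivAt_pair {Q y z : ℝ → ℝ} (h : IsSol Q y z) (t : ℝ) :
    HasDerivAt (fun x => (y x, z x)) (hillField Q t (y t, z t)) t :=
  (h.deriv₁ t).prodMk (h.deriv₂ t)

theorem lipschitzWith_hillField {Q : ℝ → ℝ} {B : ℝ≥0} (hB1 : 1 ≤ B) (hB : ∀ x, |Q x| ≤ B) (t : ℝ) :
    LipschitzWith B (hillField Q t) := by
  refine LipschitzWith.of_dist_le_mul fun p q => ?_
  have h1 : (1 : ℝ) ≤ B := by exact_mod_cast hB1
  rw [Prod.dist_eq, Prod.dist_eq]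
  apply max_le
  · calc dist p.2 q.2 ≤ max (dist p.1 q.1) (dist p.2 q.2) := le_max_right _ _
      _ ≤ _ := le_mul_of_one_le_left (le_max_of_le_left dist_nonneg) h1
  · have : dist (Q t * p.1) (Q t * q.1) = |Q t| * dist p.1 q.1 := by
      rw [Real.dist_eq, Real.dist_eq, ← mul_sub, abs_mul]
    change dist (Q t * p.1) (Q t * q.1) ≤ _
    rw [this]
    exact mul_le_mul (hB t) (le_max_left _ _) dist_nonneg (by positivity)

theorem exists_abs_le_of_periodic {Q : ℝ → ℝ} (hQ : Continuous Q) (hp : ∀ x, Q (x + 1) = Q x) :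
    ∃ B : ℝ≥0, 1 ≤ B ∧ ∀ x, |Q x| ≤ B := by
  obtain ⟨B, hB⟩ := isCompact_Icc.exists_bound_of_continuousOn (s := Icc (0 : ℝ) 1) hQ.continuousOn
  refine ⟨1 + B.toNNReal, by simp, fun x => ?_⟩
  have hper : Function.Periodic Q 1 := hp
  obtain ⟨y, hy, hxy⟩ := hper.exists_mem_Ico₀ one_pos x
  rw [hxy]
  have h1 := hB y ⟨hy.1, hy.2.le⟩
  have h2 := Real.le_coe_toNNReal B
  push_cast
  rw [Real.norm_eq_abs] at h1
  linarith

theorem IsSol.ext_of_initial {Q y₁ z₁ y₂ z₂ : ℝ → ℝ} (hQ : Continuous Q)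
    (hp : ∀ x, Q (x + 1) = Q x) (h₁ : IsSol Q y₁ z₁) (h₂ : IsSol Q y₂ z₂)
    {x₀ : ℝ} (hy : y₁ x₀ = y₂ x₀) (hz : z₁ x₀ = z₂ x₀) :
    ∀ x, y₁ x = y₂ x ∧ z₁ x = z₂ x := by
  obtain ⟨B, hB1, hB⟩ := exists_abs_le_of_periodic hQ hp
  have := ODE_solution_unique_univ (v := hillField Q) (s := fun _ => univ) (K := B) (t₀ := x₀)
    (f := fun x => (y₁ x, z₁ x)) (g := fun x => (y₂ x, z₂ x))
    (fun t => (lipschitzWith_hillField hB1 hB t).lipschitzOnWith)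
    (fun t => ⟨h₁.hasDerivAt_pair t, mem_univ _⟩) (fun t => ⟨h₂.hasDerivAt_pair t, mem_univ _⟩)
    (by simp [hy, hz])
  intro x
  simpa using congrFun this x

theorem exists_isSol {Q : ℝ → ℝ} (hQ : Continuous Q) (hp : ∀ x, Q (x + 1) = Q x) (a b : ℝ) :
    ∃ y z, IsSol Q y z ∧ y 0 = a ∧ z 0 = b := by
  obtain ⟨B, hB1, hB⟩ := exists_abs_le_of_periodic hQ hp
  obtain ⟨X, h0, hX⟩ := exists_global_solution (f := hillField Q) (K := B)
    (by unfold hillField; fun_prop) (lipschitzWith_hillField hB1 hB)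
    (fun t => by simp [hillField]) (a, b)
  refine ⟨fun x => (X x).1, fun x => (X x).2, ⟨fun x => ?_, fun x => ?_⟩, by simp [h0], by simp [h0]⟩
  · exact ((hasFDerivAt_fst (𝕜 := ℝ) (p := X x)).comp_hasDerivAt x (hX x))
  · exact ((hasFDerivAt_snd (𝕜 := ℝ) (p := X x)).comp_hasDerivAt x (hX x))

theorem IsSol.floquet {Q y z : ℝ → ℝ} (hQ : Continuous Q) (hp : ∀ x, Q (x + 1) = Q x)
    (h : IsSol Q y z) {lam : ℝ} (hy : y 1 = lam * y 0) (hz : z 1 = lam * z 0) :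
    ∀ x, y (x + 1) = lam * y x ∧ z (x + 1) = lam * z x :=
  (h.shift hp).ext_of_initial hQ hp (h.smul lam) (x₀ := 0) (by simpa using hy) (by simpa using hz)

/-- Continuous dependence of solutions at time one on the potential. -/
theorem IsSol.exists_close {Q y z : ℝ → ℝ} (hQ : Continuous Q) (hp : ∀ x, Q (x + 1) = Q x)
    (h : IsSol Q y z) {ε : ℝ} (hε : 0 < ε) :
    ∃ η > 0, ∀ {Q' y' z' : ℝ → ℝ}, (∀ x, |Q' x - Q x| ≤ η) → IsSol Q' y' z' → y' 0 = y 0 →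
      z' 0 = z 0 → |y' 1 - y 1| < ε ∧ |z' 1 - z 1| < ε := by
  obtain ⟨B, hB1, hB⟩ := exists_abs_le_of_periodic hQ hp
  obtain ⟨S, hS⟩ := isCompact_Icc.exists_bound_of_continuousOn (s := Icc (0 : ℝ) 1)
    h.continuous₁.continuousOn
  have hS0 : 0 ≤ S := (norm_nonneg _).trans (hS 0 (by simp))
  obtain ⟨η, hη, H⟩ := exists_close_of_vectorField_close (K := B + 1) hε
  refine ⟨min 1 (η / (S + 1)), by positivity, ?_⟩
  intro Q' y' z' hQ' h' hy hz
  have hB' : ∀ x, |Q' x| ≤ (B + 1 : ℝ≥0) := by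
    intro x
    have h1 := hB x
    have h2 := (hQ' x).trans (min_le_left _ _)
    have h3 : |Q' x| ≤ |Q' x - Q x| + |Q x| := by
      simpa using abs_add_le (Q' x - Q x) (Q x)
    push_cast
    linarith
  have := H (f := hillField Q') (g := hillField Q) (x := fun t => (y' t, z' t))
    (y := fun t => (y t, z t)) (lipschitzWith_hillField (by simp) hB')
    (by simp [hy, hz]) h'.hasDerivAt_pair h.hasDerivAt_pair (fun t ht => by
      have h1 : hillField Q' t (y t, z t) - hillField Q t (y t, z t) =
          (0, (Q' t - Q t) * y t) := by
        simp [hillField, sub_mul]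
      rw [h1, Prod.norm_def]
      simp only [norm_zero]
      apply max_le hη.le
      rw [norm_mul, Real.norm_eq_abs]
      calc |Q' t - Q t| * ‖y t‖ ≤ (η / (S + 1)) * (S + 1) := by
            gcongr
            · exact (hQ' t).trans (min_le_right _ _)
            · exact (hS t ht).trans (by linarith)
        _ = η := by field_simp)
  simp only [Prod.mk_sub_mk, Prod.norm_def, max_lt_iff, Real.norm_eq_abs] at this
  exact this

theorem eq_of_hasDerivAt_zero {f : ℝ → ℝ} (hf : ∀ x, HasDerivAt f 0 x) (x y : ℝ) : f x = f y :=
  is_const_of_deriv_eq_zero (fun x => (hf x).differentiableAt) (fun x => (hf x).deriv) x y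

/-- Derivative of the Wronskian. -/
theorem IsSol.hasDerivAt_wronskian {Q W y₁ z₁ y₂ z₂ : ℝ → ℝ} (h₁ : IsSol Q y₁ z₁)
    (h₂ : IsSol (fun x => Q x - W x) y₂ z₂) (x : ℝ) :
    HasDerivAt (fun x => y₁ x * z₂ x - y₂ x * z₁ x) (-W x * y₁ x * y₂ x) x :=
  (((h₁.deriv₁ x).mul (h₂.deriv₂ x)).sub ((h₂.deriv₁ x).mul (h₁.deriv₂ x))).congr_deriv (by ring)

theorem IsSol.wronskian_eq {Q y₁ z₁ y₂ z₂ : ℝ → ℝ} (h₁ : IsSol Q y₁ z₁) (h₂ : IsSol Q y₂ z₂)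
    (x x' : ℝ) : y₁ x * z₂ x - y₂ x * z₁ x = y₁ x' * z₂ x' - y₂ x' * z₁ x' :=
  eq_of_hasDerivAt_zero (f := fun x => y₁ x * z₂ x - y₂ x * z₁ x) (fun x =>
    (((h₁.deriv₁ x).mul (h₂.deriv₂ x)).sub ((h₂.deriv₁ x).mul (h₁.deriv₂ x))).congr_deriv
      (by ring)) x x'

/-! ### Fundamental systems and period maps. -/

/-- The normalized fundamental system of `y'' = Q y`. -/
structure IsFund (Q c c' s s' : ℝ → ℝ) : Prop where
  solC : IsSol Q c c'
  solS : IsSol Q s s'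
  c_zero : c 0 = 1
  c'_zero : c' 0 = 0
  s_zero : s 0 = 0
  s'_zero : s' 0 = 1

theorem exists_isFund {Q : ℝ → ℝ} (hQ : Continuous Q) (hp : ∀ x, Q (x + 1) = Q x) :
    ∃ c c' s s', IsFund Q c c' s s' := by
  obtain ⟨c, c', hc, h1, h2⟩ := exists_isSol hQ hp 1 0
  obtain ⟨s, s', hs, h3, h4⟩ := exists_isSol hQ hp 0 1
  exact ⟨c, c', s, s', hc, hs, h1, h2, h3, h4⟩

namespace IsFund

variable {Q c c' s s' y z : ℝ → ℝ}

theorem wronskian (h : IsFund Q c c' s s') (x : ℝ) : c x * s' x - s x * c' x = 1 := by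
  rw [h.solC.wronskian_eq h.solS x 0, h.c_zero, h.c'_zero, h.s_zero, h.s'_zero]; ring

theorem sol_eq (h : IsFund Q c c' s s') (hQ : Continuous Q) (hp : ∀ x, Q (x + 1) = Q x)
    (hy : IsSol Q y z) (x : ℝ) :
    y x = y 0 * c x + z 0 * s x ∧ z x = y 0 * c' x + z 0 * s' x :=
  hy.ext_of_initial hQ hp (h.solC.lincomb h.solS (y 0) (z 0)) (x₀ := 0)
    (by simp [h.c_zero, h.s_zero]) (by simp [h.c'_zero, h.s'_zero]) x

/-- A period map with a real eigenvalue has a real Floquet solution. -/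
theorem exists_floquet_of_eigenvalue (h : IsFund Q c c' s s') (hQ : Continuous Q)
    (hp : ∀ x, Q (x + 1) = Q x) {lam : ℝ} (hlam : lam ^ 2 - (c 1 + s' 1) * lam + 1 = 0) :
    ∃ y z, IsSol Q y z ∧ (y 0 ≠ 0 ∨ z 0 ≠ 0) ∧ ∀ x, y (x + 1) = lam * y x ∧ z (x + 1) = lam * z x := by
  have hw := h.wronskian 1
  have key : ∃ a b : ℝ, (a ≠ 0 ∨ b ≠ 0) ∧ a * c 1 + b * s 1 = lam * a ∧
      a * c' 1 + b * s' 1 = lam * b := by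
    by_cases hs : s 1 = 0
    · by_cases hc : c 1 = lam
      · by_cases hc2 : s' 1 = lam
        · by_cases hc3 : c' 1 = 0
          · exact ⟨1, 0, by simp, by simp [hc], by simp [hc3]⟩
          · exact ⟨0, 1, by simp, by simp [hs], by simp [hc2]⟩
        · refine ⟨lam - s' 1, c' 1, Or.inl (sub_ne_zero.2 (Ne.symm hc2)), ?_, ?_⟩
          · rw [hs, hc]; ring
          · ring
      · refine ⟨0, 1, by simp, by simp [hs], ?_⟩
        have : (lam - c 1) * (lam - s' 1) = 0 := by
          rw [hs] at hw; linear_combination hlam + hw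
        rcases mul_eq_zero.1 this with h' | h'
        · exact absurd (sub_eq_zero.1 h').symm hc
        · linarith
    · exact ⟨s 1, lam - c 1, Or.inl hs, by ring, by linear_combination -hlam - hw⟩
  obtain ⟨a, b, hab, h1, h2⟩ := key
  have hsol := h.solC.lincomb h.solS a b
  refine ⟨_, _, hsol, by simpa [h.c_zero, h.s_zero, h.c'_zero, h.s'_zero] using hab, ?_⟩
  apply hsol.floquet hQ hp
  · simpa [h.c_zero, h.s_zero, h.c'_zero, h.s'_zero] using h1
  · simpa [h.c_zero, h.s_zero, h.c'_zero, h.s'_zero] using h2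

/-- The characteristic polynomial has discriminant `trace² - 4`. Read contrapositively, this is the
route to ellipticity: it suffices to exclude real Floquet solutions. -/
theorem exists_real_floquet (h : IsFund Q c c' s s') (hQ : Continuous Q)
    (hp : ∀ x, Q (x + 1) = Q x) (htr : 2 ≤ |c 1 + s' 1|) :
    ∃ lam : ℝ, ∃ y z, IsSol Q y z ∧ (y 0 ≠ 0 ∨ z 0 ≠ 0) ∧
      ∀ x, y (x + 1) = lam * y x ∧ z (x + 1) = lam * z x := by
  set T := c 1 + s' 1 with hT
  have h4 : 0 ≤ T ^ 2 - 4 := by nlinarith [sq_abs T, abs_nonneg T]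
  refine ⟨(T + Real.sqrt (T ^ 2 - 4)) / 2, h.exists_floquet_of_eigenvalue hQ hp ?_⟩
  rw [← hT]
  linear_combination (1 / 4) * Real.sq_sqrt h4

/-- An elliptic period map rotates all vectors in the same direction. -/
theorem rotation_definite (h : IsFund Q c c' s s') (hQ : Continuous Q)
    (hp : ∀ x, Q (x + 1) = Q x) (htr : |c 1 + s' 1| < 2) {y₁ z₁ y₂ z₂ : ℝ → ℝ}
    (h₁ : IsSol Q y₁ z₁) (h₂ : IsSol Q y₂ z₂) (hn₁ : y₁ 0 ≠ 0 ∨ z₁ 0 ≠ 0)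
    (hn₂ : y₂ 0 ≠ 0 ∨ z₂ 0 ≠ 0) :
    0 < (y₁ 0 * z₁ 1 - z₁ 0 * y₁ 1) * (y₂ 0 * z₂ 1 - z₂ 0 * y₂ 1) := by
  have hw := h.wronskian 1
  have hT : (c 1 + s' 1) ^ 2 < 4 := by
    nlinarith [sq_abs (c 1 + s' 1), abs_nonneg (c 1 + s' 1)]
  set p := c' 1
  set q := s' 1 - c 1
  set r := s 1
  -- The quantity `y 0 * z 1 - z 0 * y 1` is a quadratic form in the initial data whose discriminant
  -- is again `trace² - 4`, so an elliptic map makes it definite.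
  have hd : q ^ 2 + 4 * p * r < 0 := by
    have : q ^ 2 + 4 * p * r = (c 1 + s' 1) ^ 2 - 4 := by
      simp only [p, q, r]; linear_combination -4 * hw
    linarith
  have hp0 : p ≠ 0 := by
    intro h0; rw [h0] at hd; nlinarith [sq_nonneg q]
  have hpos : ∀ a b : ℝ, (a ≠ 0 ∨ b ≠ 0) → 0 < p * (p * a ^ 2 + q * a * b - r * b ^ 2) := by
    intro a b hab
    have h4 : 4 * (p * (p * a ^ 2 + q * a * b - r * b ^ 2)) =
        (2 * p * a + q * b) ^ 2 + (-(q ^ 2 + 4 * p * r)) * b ^ 2 := by ring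
    by_cases hb : b = 0
    · have ha : a ≠ 0 := by simpa [hb] using hab
      have : 0 < (p * a) ^ 2 := by positivity
      rw [hb]; linarith
    · have : 0 < b ^ 2 := by positivity
      nlinarith [sq_nonneg (2 * p * a + q * b)]
  have e₁ : y₁ 0 * z₁ 1 - z₁ 0 * y₁ 1 =
      p * y₁ 0 ^ 2 + q * y₁ 0 * z₁ 0 - r * z₁ 0 ^ 2 := by
    obtain ⟨ha, hb⟩ := h.sol_eq hQ hp h₁ 1
    rw [ha, hb]; simp only [p, q, r]; ring
  have e₂ : y₂ 0 * z₂ 1 - z₂ 0 * y₂ 1 =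
      p * y₂ 0 ^ 2 + q * y₂ 0 * z₂ 0 - r * z₂ 0 ^ 2 := by
    obtain ⟨ha, hb⟩ := h.sol_eq hQ hp h₂ 1
    rw [ha, hb]; simp only [p, q, r]; ring
  have := mul_pos (hpos _ _ hn₁) (hpos _ _ hn₂)
  rw [← e₁, ← e₂] at this
  have hpp : 0 < p * p := mul_self_pos.2 hp0
  by_contra hcon
  nlinarith [mul_nonneg hpp.le (not_lt.1 hcon |> sub_nonneg.2)]

end IsFund

theorem solvesHill_iff {q : ℝ → ℝ} {E : ℝ} (hq : Continuous q) {y : ℝ → ℝ} :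
    SolvesHill q E y ↔ IsSol (fun x => 2 * (q x - E)) y (deriv y) := by
  constructor
  · rintro ⟨h1, h2⟩
    have hd : Differentiable ℝ y := h1.differentiable (by norm_num)
    have hd2 : Differentiable ℝ (deriv y) :=
      ((contDiff_succ_iff_deriv (n := 1)).1 h1).2.2.differentiable (by norm_num)
    refine ⟨fun x => (hd x).hasDerivAt, fun x => (hd2 x).hasDerivAt.congr_deriv ?_⟩
    have := h2 x
    rw [iteratedDeriv_succ, iteratedDeriv_one] at this
    linear_combination -2 * this
  · intro h
    have hc := h.continuous₁
    have hdd : deriv (deriv y) = fun x => 2 * (q x - E) * y x := funext fun x => (h.deriv₂ x).deriv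
    refine ⟨?_, fun x => ?_⟩
    · refine (contDiff_succ_iff_deriv (n := 1)).2
        ⟨fun x => (h.deriv₁ x).differentiableAt, by simp, ?_⟩
      refine contDiff_one_iff_deriv.2 ⟨fun x => (h.deriv₂ x).differentiableAt, ?_⟩
      rw [hdd]; fun_prop
    · rw [iteratedDeriv_succ, iteratedDeriv_one, hdd]; ring

theorem isDiscriminant_iff {q : ℝ → ℝ} (hq : Continuous q) {E D : ℝ} :
    IsDiscriminant q E D ↔ ∃ c c' s s', IsFund (fun x => 2 * (q x - E)) c c' s s' ∧
      D = c 1 + s' 1 := by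
  constructor
  · rintro ⟨c, s, hc, hs, h1, h2, h3, h4, h5⟩
    exact ⟨c, _, s, _, ⟨(solvesHill_iff hq).1 hc, (solvesHill_iff hq).1 hs, h1, h2, h3, h4⟩, h5⟩
  · rintro ⟨c, c', s, s', h, hD⟩
    have hc : deriv c = c' := funext fun x => (h.solC.deriv₁ x).deriv
    have hs : deriv s = s' := funext fun x => (h.solS.deriv₁ x).deriv
    subst hc hs
    exact ⟨c, s, (solvesHill_iff hq).2 h.solC, (solvesHill_iff hq).2 h.solS, h.c_zero, h.c'_zero,
      h.s_zero, h.s'_zero, hD⟩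

/-! ### Comparison of a parabolic equation with a small perturbation of one sign. -/

/-- The energy has derivative `2(Q + κ²) y z`, and `2|y z| ≤ κ²y² + z²` because `κ ≥ 1`. A `κ²` that
compensates a large negative constant in `Q` keeps the growth rate `B` bounded. -/
theorem IsSol.energy_le {Q y z : ℝ → ℝ} (h : IsSol Q y z) {κ B : ℝ} (hκ : 1 ≤ κ)
    (hB : ∀ x, |Q x + κ ^ 2| ≤ B) (x x' : ℝ) :
    κ ^ 2 * y x ^ 2 + z x ^ 2 ≤ Real.exp (B * |x - x'|) * (κ ^ 2 * y x' ^ 2 + z x' ^ 2) := by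
  set e : ℝ → ℝ := fun x => κ ^ 2 * y x ^ 2 + z x ^ 2 with he
  have hde : ∀ x, HasDerivAt e (2 * (Q x + κ ^ 2) * (y x * z x)) x := fun x =>
    ((((h.deriv₁ x).pow 2).const_mul (κ ^ 2)).add ((h.deriv₂ x).pow 2)).congr_deriv
      (by simp; ring)
  have hbd : ∀ x, |2 * (Q x + κ ^ 2) * (y x * z x)| ≤ B * e x := by
    intro x
    have h1 : |2 * (y x * z x)| ≤ e x := by
      have : y x ^ 2 ≤ κ ^ 2 * y x ^ 2 := le_mul_of_one_le_left (sq_nonneg _) (by nlinarith)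
      rw [abs_le]; simp only [he]
      constructor <;> nlinarith [sq_nonneg (y x + z x), sq_nonneg (y x - z x)]
    calc |2 * (Q x + κ ^ 2) * (y x * z x)| = |Q x + κ ^ 2| * |2 * (y x * z x)| := by
          rw [← abs_mul]; ring_nf
      _ ≤ B * e x := mul_le_mul (hB x) h1 (abs_nonneg _) ((abs_nonneg _).trans (hB x))
  have hexp : ∀ k x, HasDerivAt (fun x => Real.exp (k * x)) (k * Real.exp (k * x)) x := fun k x => by
    simpa [mul_comm] using ((hasDerivAt_id x).const_mul k).exp
  have hd : ∀ k x, HasDerivAt (fun x => e x * Real.exp (k * x))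
      ((2 * (Q x + κ ^ 2) * (y x * z x) + k * e x) * Real.exp (k * x)) x := fun k x =>
    ((hde x).mul (hexp k x)).congr_deriv (by ring)
  have hanti : Antitone fun x => e x * Real.exp (-B * x) := by
    refine antitone_of_deriv_nonpos (fun x => (hd _ x).differentiableAt) fun x => ?_
    rw [(hd _ x).deriv]
    refine mul_nonpos_of_nonpos_of_nonneg ?_ (Real.exp_pos _).le
    linarith [(abs_le.1 (hbd x)).2]
  have hmono : Monotone fun x => e x * Real.exp (B * x) := by
    refine monotone_of_deriv_nonneg (fun x => (hd _ x).differentiableAt) fun x => ?_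
    rw [(hd _ x).deriv]
    refine mul_nonneg ?_ (Real.exp_pos _).le
    linarith [(abs_le.1 (hbd x)).1]
  rcases le_total x x' with hx | hx
  · have := hmono hx
    simp only at this
    rw [abs_of_nonpos (by linarith), show B * -(x - x') = B * x' - B * x by ring, Real.exp_sub,
      div_mul_eq_mul_div, le_div_iff₀ (Real.exp_pos _)]
    linarith
  · have := hanti hx
    simp only [neg_mul, Real.exp_neg, ← div_eq_mul_inv] at this
    rw [abs_of_nonneg (by linarith), show B * (x - x') = B * x - B * x' by ring, Real.exp_sub,
      div_mul_eq_mul_div]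
    rw [div_le_div_iff₀ (Real.exp_pos _) (Real.exp_pos _)] at this
    rw [le_div_iff₀ (Real.exp_pos _)]
    linarith

/-- `W` is a perturbation of the potential `Q`, small in the scale given by `κ` and `B`. -/
structure IsSmallPerturbation (Q W : ℝ → ℝ) (κ B η : ℝ) : Prop where
  continuous : Continuous W
  one_le : 1 ≤ κ
  bound : ∀ x, |Q x + κ ^ 2| ≤ B
  bound' : ∀ x, |Q x - W x + κ ^ 2| ≤ B
  abs_le : ∀ x, |W x| ≤ η
  small : η * Real.exp B < 1

section Comparison

variable {Q W φ ψ y z : ℝ → ℝ} {κ B η s x₀ : ℝ}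

theorem IsSol.energy_pos (h : IsSol Q y z) (hκ : 1 ≤ κ)
    (hB : ∀ x, |Q x + κ ^ 2| ≤ B) (hn : y x₀ ≠ 0 ∨ z x₀ ≠ 0) (x : ℝ) :
    0 < κ ^ 2 * y x ^ 2 + z x ^ 2 := by
  have h1 := h.energy_le hκ hB x₀ x
  have hpos : 0 < κ ^ 2 * y x₀ ^ 2 + z x₀ ^ 2 := by
    rcases hn with hn | hn <;> positivity
  by_contra hcon
  have := mul_nonpos_of_nonneg_of_nonpos (Real.exp_pos (B * |x₀ - x|)).le (not_lt.1 hcon)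
  linarith

/-- Two solutions that are parallel at `x₀` stay away from being orthogonal on `[x₀, x₀ + 1]`. -/
theorem IsSmallPerturbation.inner_ne_zero (hS : IsSmallPerturbation Q W κ B η) (hφ : IsSol Q φ ψ)
    (hy : IsSol (fun x => Q x - W x) y z) (hn : φ x₀ ≠ 0 ∨ ψ x₀ ≠ 0) (hny : y x₀ ≠ 0 ∨ z x₀ ≠ 0)
    (hD : φ x₀ * z x₀ - y x₀ * ψ x₀ = 0) {x : ℝ} (hx : x ∈ Icc x₀ (x₀ + 1)) :
    κ ^ 2 * (φ x * y x) + ψ x * z x ≠ 0 := by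
  intro hP
  have hκ := hS.one_le
  have hη : 0 ≤ η := (abs_nonneg _).trans (hS.abs_le x)
  have hB0 : 0 ≤ B := (abs_nonneg _).trans (hS.bound x)
  have e₁ := hφ.energy_pos hκ hS.bound hn x
  have e₂ := hy.energy_pos hκ hS.bound' hny x
  -- By Lagrange's identity the product of the energies is the square of the inner product plus `κ²`
  -- times the square of the Wronskian. Where the inner product vanishes, the Wronskian has absolute
  -- value `m/κ`. Starting from `0` it can reach at most `η e^B m/κ²` within a period, which is
  -- smaller.
  set m := Real.sqrt ((κ ^ 2 * φ x ^ 2 + ψ x ^ 2) * (κ ^ 2 * y x ^ 2 + z x ^ 2)) with hm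
  have hmpos : 0 < m := Real.sqrt_pos.2 (mul_pos e₁ e₂)
  have hm2 : m ^ 2 = (κ ^ 2 * φ x ^ 2 + ψ x ^ 2) * (κ ^ 2 * y x ^ 2 + z x ^ 2) :=
    Real.sq_sqrt (mul_pos e₁ e₂).le
  have hprod : ∀ t ∈ Icc x₀ (x₀ + 1), κ ^ 2 * |φ t * y t| ≤ Real.exp B * m := by
    intro t ht
    have hexp : Real.exp (B * |t - x|) ≤ Real.exp B := by
      apply Real.exp_le_exp.2
      apply mul_le_of_le_one_right hB0
      rw [_root_.abs_le]; constructor <;> linarith [hx.1, hx.2, ht.1, ht.2]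
    have h1 : κ ^ 2 * φ t ^ 2 ≤ Real.exp B * (κ ^ 2 * φ x ^ 2 + ψ x ^ 2) := by
      have := hφ.energy_le hκ hS.bound t x
      have := mul_le_mul_of_nonneg_right hexp e₁.le
      linarith [sq_nonneg (ψ t)]
    have h2 : κ ^ 2 * y t ^ 2 ≤ Real.exp B * (κ ^ 2 * y x ^ 2 + z x ^ 2) := by
      have := hy.energy_le hκ hS.bound' t x
      have := mul_le_mul_of_nonneg_right hexp e₂.le
      linarith [sq_nonneg (z t)]
    apply abs_le_of_sq_le_sq' _ (by positivity) |>.2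
    have h3 := mul_le_mul h1 h2 (by positivity) (by positivity)
    calc (κ ^ 2 * |φ t * y t|) ^ 2 = (κ ^ 2 * φ t ^ 2) * (κ ^ 2 * y t ^ 2) := by
          rw [mul_pow, sq_abs]; ring
      _ ≤ _ := h3
      _ = (Real.exp B * m) ^ 2 := by rw [mul_pow, hm2]; ring
  have hκ2 : 0 < κ ^ 2 := by positivity
  have hmv := (convex_Icc x₀ (x₀ + 1)).norm_image_sub_le_of_norm_hasDerivWithin_le
    (f := fun x => φ x * z x - y x * ψ x) (f' := fun x => -W x * φ x * y x)
    (C := η * (Real.exp B * m / κ ^ 2)) (x := x₀) (y := x)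
    (fun t _ => (hφ.hasDerivAt_wronskian hy t).hasDerivWithinAt)
    (fun t ht => by
      rw [Real.norm_eq_abs, mul_assoc, abs_mul, abs_neg]
      apply mul_le_mul (hS.abs_le t) _ (abs_nonneg _) hη
      rw [le_div_iff₀ hκ2]; linarith [hprod t ht])
    (by simp) hx
  simp only [hD, sub_zero, Real.norm_eq_abs] at hmv
  have hlen : |x - x₀| ≤ 1 := by rw [_root_.abs_le]; constructor <;> linarith [hx.1, hx.2]
  have hD1 : |φ x * z x - y x * ψ x| ≤ η * (Real.exp B * m / κ ^ 2) :=
    hmv.trans (mul_le_of_le_one_right (by positivity) hlen)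
  have hD2 : κ * |φ x * z x - y x * ψ x| = m := by
    rw [← sq_eq_sq₀ (by positivity) hmpos.le, mul_pow, sq_abs, hm2]
    linear_combination -(κ ^ 2 * (φ x * y x) + ψ x * z x) * hP
  have hD3 : κ ^ 2 * |φ x * z x - y x * ψ x| ≤ η * Real.exp B * m := by
    calc _ ≤ κ ^ 2 * (η * (Real.exp B * m / κ ^ 2)) := by gcongr
      _ = _ := by field_simp
  have h5 : η * Real.exp B * m < 1 * m := mul_lt_mul_of_pos_right hS.small hmpos
  have h6 : m ≤ κ * m := le_mul_of_one_le_left hmpos.le hκ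
  have h7 : κ ^ 2 * |φ x * z x - y x * ψ x| = κ * m := by rw [← hD2]; ring
  linarith

theorem IsSol.exists_ne_zero (h : IsSol Q y z) (hn : ∀ x, y x ≠ 0 ∨ z x ≠ 0) (x₀ : ℝ) :
    ∃ x ∈ Ioo x₀ (x₀ + 1), y x ≠ 0 := by
  by_contra! hcon
  have hmem : Ioo x₀ (x₀ + 1) ∈ 𝓝 (x₀ + 1 / 2) := Ioo_mem_nhds (by linarith) (by linarith)
  have h0 : HasDerivAt y 0 (x₀ + 1 / 2) :=
    (hasDerivAt_const (x₀ + 1 / 2) (0 : ℝ)).congr_of_eventuallyEq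
      (Filter.eventually_of_mem hmem fun x hx => hcon x hx)
  have h1 := (h.deriv₁ _).unique h0
  rcases hn (x₀ + 1 / 2) with h2 | h2
  · exact h2 (hcon _ (mem_of_mem_nhds hmem))
  · exact h2 h1

/-- The Wronskian crosses zero in one direction only. -/
theorem IsSmallPerturbation.wronskian_neg (hS : IsSmallPerturbation Q W κ B η) (hφ : IsSol Q φ ψ)
    (hy : IsSol (fun x => Q x - W x) y z) (hW : ∀ x, φ x ≠ 0 → 0 < s * W x)
    (hD : φ x₀ * z x₀ - y x₀ * ψ x₀ = 0) (hP : 0 < κ ^ 2 * (φ x₀ * y x₀) + ψ x₀ * z x₀) :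
    s * (φ (x₀ + 1) * z (x₀ + 1) - y (x₀ + 1) * ψ (x₀ + 1)) < 0 := by
  have hn : φ x₀ ≠ 0 ∨ ψ x₀ ≠ 0 := by
    by_contra! h; simp [h.1, h.2] at hP
  have hny : y x₀ ≠ 0 ∨ z x₀ ≠ 0 := by
    by_contra! h; simp [h.1, h.2] at hP
  have hcφ := hφ.continuous₁
  have hcψ := hφ.continuous₂
  have hcy := hy.continuous₁
  have hcz := hy.continuous₂
  have hWc := hS.continuous
  have hpos : ∀ x ∈ Icc x₀ (x₀ + 1), 0 < κ ^ 2 * (φ x * y x) + ψ x * z x := by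
    intro x hx
    by_contra hneg
    have hc : ContinuousOn (fun x => κ ^ 2 * (φ x * y x) + ψ x * z x) (Icc x₀ x) :=
      Continuous.continuousOn (by fun_prop)
    obtain ⟨t, ht, h0⟩ := intermediate_value_Icc' hx.1 hc ⟨not_lt.1 hneg, hP.le⟩
    exact hS.inner_ne_zero hφ hy hn hny hD ⟨ht.1, ht.2.trans hx.2⟩ h0
  set e : ℝ → ℝ := fun x => κ ^ 2 * φ x ^ 2 + ψ x ^ 2 with he
  have hepos : ∀ x, 0 < e x := hφ.energy_pos hS.one_le hS.bound hn
  -- The sign of `D' = -Wφy` is unclear where `φ` and `y` disagree in sign. Splitting `(y, z)` along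
  -- `(φ, ψ)` and its orthogonal gives `D' = b D - Wφ²P/e` with `P > 0` the inner product, and the
  -- integrating factor `exp (-G)` removes the term `b D`.
  set b : ℝ → ℝ := fun x => W x * φ x * ψ x / e x with hb
  have hbc : Continuous b := by
    refine Continuous.div (by fun_prop) (by fun_prop) fun x => (hepos x).ne'
  set G : ℝ → ℝ := fun x => ∫ t in (0 : ℝ)..x, b t with hG
  have hGd : ∀ x, HasDerivAt G (b x) x := fun x =>
    (hbc.integral_hasStrictDerivAt 0 x).hasDerivAt
  set D : ℝ → ℝ := fun x => φ x * z x - y x * ψ x with hDdef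
  set F : ℝ → ℝ := fun x => s * D x * Real.exp (-G x) with hF
  have hyid : ∀ x, y x * e x = φ x * (κ ^ 2 * (φ x * y x) + ψ x * z x) - ψ x * D x := by
    intro x; simp only [he, hDdef]; ring
  have hFd : ∀ x, HasDerivAt F (-(s * W x) * φ x ^ 2 * (κ ^ 2 * (φ x * y x) + ψ x * z x) / e x *
      Real.exp (-G x)) x := by
    intro x
    refine (((hφ.hasDerivAt_wronskian hy x).const_mul s).mul (hGd x).neg.exp).congr_deriv ?_
    have h2 : -W x * φ x * y x = -(W x) * φ x ^ 2 * (κ ^ 2 * (φ x * y x) + ψ x * z x) / e x +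
        b x * D x := by
      have he0 := (hepos x).ne'
      calc -W x * φ x * y x = -(W x * φ x) * (y x * e x) / e x := by field_simp
        _ = _ := by rw [hyid]; simp only [hb]; ring
    rw [h2]; simp only [hDdef, Pi.neg_apply]; ring
  have hsW : ∀ x, 0 ≤ s * W x * φ x ^ 2 := by
    intro x
    by_cases h : φ x = 0
    · simp [h]
    · exact mul_nonneg (hW x h).le (sq_nonneg _)
  have hanti : AntitoneOn F (Icc x₀ (x₀ + 1)) := by
    apply antitoneOn_of_deriv_nonpos (convex_Icc _ _)
      (fun x _ => (hFd x).continuousAt.continuousWithinAt)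
      (fun x _ => (hFd x).differentiableAt.differentiableWithinAt)
    intro x hx
    rw [interior_Icc] at hx
    rw [(hFd x).deriv]
    have h1 := mul_nonneg (hsW x) (hpos x (Ioo_subset_Icc_self hx)).le
    have h2 := div_nonneg h1 (hepos x).le
    have h3 := mul_nonneg h2 (Real.exp_pos (-G x)).le
    calc _ = -(s * W x * φ x ^ 2 * (κ ^ 2 * (φ x * y x) + ψ x * z x) / e x *
        Real.exp (-G x)) := by ring
      _ ≤ 0 := by linarith
  have hl : x₀ ∈ Icc x₀ (x₀ + 1) := ⟨le_rfl, by linarith⟩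
  have hr : x₀ + 1 ∈ Icc x₀ (x₀ + 1) := ⟨by linarith, le_rfl⟩
  have hF0 : F x₀ = 0 := by simp only [hF, hDdef, hD]; ring
  -- Without a strict drop, `F` would be constant on the interval, although its slope is nonzero
  -- wherever `φ ≠ 0`.
  by_contra hcon
  have hF1 : 0 ≤ F (x₀ + 1) := mul_nonneg (not_lt.1 hcon) (Real.exp_pos _).le
  obtain ⟨ξ, hξ, hφξ⟩ := hφ.exists_ne_zero (fun x => by
    by_contra! h
    have := hepos x
    simp [he, h.1, h.2] at this) x₀
  have hFz : ∀ x ∈ Icc x₀ (x₀ + 1), F x = 0 := fun x hx =>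
    le_antisymm (hF0 ▸ hanti hl hx hx.1) (hF1.trans (hanti hx hr hx.2))
  have hd0 : HasDerivAt F 0 ξ := (hasDerivAt_const ξ (0 : ℝ)).congr_of_eventuallyEq
    (Filter.eventually_of_mem (Ioo_mem_nhds hξ.1 hξ.2) fun x hx => hFz x (Ioo_subset_Icc_self hx))
  have h1 := (hFd ξ).unique hd0
  have h2 : 0 < s * W ξ * φ ξ ^ 2 * (κ ^ 2 * (φ ξ * y ξ) + ψ ξ * z ξ) / e ξ * Real.exp (-G ξ) := by
    have h3 := hW ξ hφξ
    have h4 := hpos ξ (Ioo_subset_Icc_self hξ)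
    have h5 := hepos ξ
    positivity
  have h6 : -(s * W ξ) * φ ξ ^ 2 * (κ ^ 2 * (φ ξ * y ξ) + ψ ξ * z ξ) / e ξ * Real.exp (-G ξ) =
    -(s * W ξ * φ ξ ^ 2 * (κ ^ 2 * (φ ξ * y ξ) + ψ ξ * z ξ) / e ξ * Real.exp (-G ξ)) := by ring
  linarith

/-- Parallel nonzero vectors have nonzero inner product. Passing to `-y` if necessary makes it
positive, and then the Wronskian leaves zero strictly in a known direction. -/
theorem IsSmallPerturbation.wronskian_ne_zero (hS : IsSmallPerturbation Q W κ B η)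
    (hφ : IsSol Q φ ψ) (hy : IsSol (fun x => Q x - W x) y z) (hW : ∀ x, φ x ≠ 0 → 0 < s * W x)
    (hn : φ x₀ ≠ 0 ∨ ψ x₀ ≠ 0) (hny : y x₀ ≠ 0 ∨ z x₀ ≠ 0)
    (hD : φ x₀ * z x₀ - y x₀ * ψ x₀ = 0) :
    φ (x₀ + 1) * z (x₀ + 1) - y (x₀ + 1) * ψ (x₀ + 1) ≠ 0 := by
  intro h
  rcases (hS.inner_ne_zero hφ hy hn hny hD (x := x₀) ⟨le_rfl, by linarith⟩).lt_or_gt with h1 | h1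
  · have := hS.wronskian_neg (s := s) (x₀ := x₀) hφ (hy.smul (-1)) hW (by linarith) (by linarith)
    have h2 : φ (x₀ + 1) * (-1 * z (x₀ + 1)) - -1 * y (x₀ + 1) * ψ (x₀ + 1) = 0 := by linarith
    rw [h2] at this
    simp at this
  · have := hS.wronskian_neg (s := s) hφ hy hW hD h1
    rw [h] at this
    simp at this

/-- If the Jordan coefficient `c` of the parabolic period map of `Q` has the sign of the
perturbation, then the perturbed period map has no real Floquet solution. -/
theorem IsSmallPerturbation.no_real_floquet (hS : IsSmallPerturbation Q W κ B η)
    (hφ : IsSol Q φ ψ) (hn : ∀ x, φ x ≠ 0 ∨ ψ x ≠ 0) {ε c : ℝ} (hε : ε ^ 2 = 1)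
    (hφp : ∀ x, φ (x + 1) = ε * φ x ∧ ψ (x + 1) = ε * ψ x)
    {φ₂ ψ₂ : ℝ → ℝ} (hφ₂ : IsSol Q φ₂ ψ₂)
    (hw : ∀ x, φ x * ψ₂ x - φ₂ x * ψ x = 1)
    (hφ₂p : ∀ x, φ₂ (x + 1) = ε * (φ₂ x + c * φ x) ∧ ψ₂ (x + 1) = ε * (ψ₂ x + c * ψ x))
    (hc : 0 ≤ s * c) (hW0 : ∀ x, 0 ≤ s * W x) (hW : ∀ x, φ x ≠ 0 → 0 < s * W x)
    (hy : IsSol (fun x => Q x - W x) y z) (hny : y x₀ ≠ 0 ∨ z x₀ ≠ 0) {lam : ℝ}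
    (hyp : ∀ x, y (x + 1) = lam * y x ∧ z (x + 1) = lam * z x) : False := by
  -- `a` and `D` are the coordinates of `y` along `φ` and `φ₂`; the quotient `a / D` plays the role
  -- of a phase.
  set D : ℝ → ℝ := fun x => φ x * z x - y x * ψ x with hD
  set a : ℝ → ℝ := fun x => y x * ψ₂ x - φ₂ x * z x with ha
  have hε0 : ε ≠ 0 := by rintro rfl; norm_num at hε
  have hnyall : ∀ x, y x ≠ 0 ∨ z x ≠ 0 := by
    intro x
    have := hy.energy_pos hS.one_le hS.bound' hny x
    by_contra! h
    simp [h.1, h.2] at this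
  have hDp : ∀ x, D (x + 1) = ε * lam * D x := by
    intro x
    simp only [hD, hφp x, hyp x]; ring
  have hap : ∀ x, a (x + 1) = ε * lam * (a x - c * D x) := by
    intro x
    simp only [ha, hD, hφ₂p x, hyp x]; ring
  -- A zero of `D` would recur one period later, since `D` is multiplied by `ε * lam`. So the phase
  -- never becomes infinite.
  have hDne : ∀ x, D x ≠ 0 := by
    intro x hx
    exact hS.wronskian_ne_zero hφ hy hW (hn x) (hnyall x) hx (by
      have := hDp x; rw [hx, mul_zero] at this; exact this)
  have hlam : ε * lam ≠ 0 := by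
    intro h
    exact hDne (0 + 1) (by rw [hDp, h, zero_mul])
  have hDd : ∀ x, HasDerivAt D (-W x * φ x * y x) x := fun x => hφ.hasDerivAt_wronskian hy x
  have had : ∀ x, HasDerivAt a (W x * φ₂ x * y x) x := fun x =>
    (((hy.deriv₁ x).mul (hφ₂.deriv₂ x)).sub ((hφ₂.deriv₁ x).mul (hy.deriv₂ x))).congr_deriv
      (by ring)
  have hyid : ∀ x, y x = a x * φ x + D x * φ₂ x := by
    intro x
    simp only [ha, hD]
    linear_combination -(y x) * hw x
  have hrd : ∀ x, HasDerivAt (fun x => s * (a x / D x)) (s * W x * (y x ^ 2 / D x ^ 2)) x := by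
    intro x
    refine (((had x).div (hDd x) (hDne x)).const_mul s).congr_deriv ?_
    have : W x * φ₂ x * y x * D x - a x * (-W x * φ x * y x) = W x * y x ^ 2 := by
      linear_combination -(W x * y x) * hyid x
    rw [this]; ring
  -- The perturbation drives `s a / D` upwards with slope `s W y² / D²`, while one period changes it
  -- by `-s c ≤ 0`. It is therefore constant over a period, which forces `y = 0` wherever `φ ≠ 0`.
  have hmono : Monotone fun x => s * (a x / D x) := by
    refine monotone_of_deriv_nonneg (fun x => (hrd x).differentiableAt) fun x => ?_
    rw [(hrd x).deriv]
    exact mul_nonneg (hW0 x) (by positivity)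
  have hper : s * (a (0 + 1) / D (0 + 1)) ≤ s * (a 0 / D 0) := by
    have : a (0 + 1) / D (0 + 1) = a 0 / D 0 - c := by
      rw [hap, hDp, mul_div_mul_left _ _ hlam, sub_div, mul_div_assoc, div_self (hDne 0), mul_one]
    rw [this]; linarith
  obtain ⟨ξ, hξ, hφξ⟩ := hφ.exists_ne_zero hn 0
  have hnear : ∀ᶠ x in 𝓝 ξ, x ∈ Ioo (0 : ℝ) (0 + 1) ∧ φ x ≠ 0 :=
    Filter.Eventually.and (Ioo_mem_nhds hξ.1 hξ.2)
      (hφ.continuous₁.continuousAt.eventually_ne hφξ)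
  have hconst : ∀ x ∈ Icc (0 : ℝ) (0 + 1), s * (a x / D x) = s * (a 0 / D 0) := fun x hx =>
    le_antisymm ((hmono hx.2).trans hper) (hmono hx.1)
  have hyz : ∀ x ∈ Ioo (0 : ℝ) (0 + 1), φ x ≠ 0 → y x = 0 := by
    intro x hx hφx
    have h0 : HasDerivAt (fun x => s * (a x / D x)) 0 x :=
      (hasDerivAt_const x (s * (a 0 / D 0))).congr_of_eventuallyEq
        (Filter.eventually_of_mem (Ioo_mem_nhds hx.1 hx.2) fun t ht =>
          hconst t (Ioo_subset_Icc_self ht))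
    have h1 := (hrd x).unique h0
    have h2 := hW x hφx
    by_contra hy0
    have : 0 < s * W x * (y x ^ 2 / D x ^ 2) := by
      have := hDne x
      positivity
    linarith
  have hy0 : y =ᶠ[𝓝 ξ] fun _ => 0 := hnear.mono fun x hx => hyz x hx.1 hx.2
  have hz0 := (hy.deriv₁ ξ).unique ((hasDerivAt_const ξ (0 : ℝ)).congr_of_eventuallyEq hy0)
  rcases hnyall ξ with h | h
  · exact h hy0.self_of_nhds
  · exact h hz0

end Comparison

/-! ### Parabolic period maps and their Jordan coefficient. -/

/-- The period map of `y'' = Q y` is `ε` times a Jordan block with coefficient `c` in the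
basis `φ`, `φ₂` of solutions, with `ε = ±1`. -/
structure IsParabolic (Q φ ψ φ₂ ψ₂ : ℝ → ℝ) (ε c : ℝ) : Prop where
  sol₁ : IsSol Q φ ψ
  sol₂ : IsSol Q φ₂ ψ₂
  sq_eq_one : ε ^ 2 = 1
  wronskian : ∀ x, φ x * ψ₂ x - φ₂ x * ψ x = 1
  shift₁ : ∀ x, φ (x + 1) = ε * φ x ∧ ψ (x + 1) = ε * ψ x
  shift₂ : ∀ x, φ₂ (x + 1) = ε * (φ₂ x + c * φ x) ∧ ψ₂ (x + 1) = ε * (ψ₂ x + c * ψ x)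

/-- The period map has determinant one and the eigenvalue `ε = ε⁻¹`, so it also multiplies the
second basis vector by `ε`, up to a multiple of `φ`. That vector starts as `(φ, ψ)` turned by a
right angle and scaled to unit Wronskian. -/
theorem IsSol.exists_isParabolic {Q φ ψ : ℝ → ℝ} (hQ : Continuous Q)
    (hp : ∀ x, Q (x + 1) = Q x) (h : IsSol Q φ ψ) (hn : φ 0 ≠ 0 ∨ ψ 0 ≠ 0) {ε : ℝ} (hε : ε ^ 2 = 1)
    (hs : ∀ x, φ (x + 1) = ε * φ x ∧ ψ (x + 1) = ε * ψ x) :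
    ∃ φ₂ ψ₂ c, IsParabolic Q φ ψ φ₂ ψ₂ ε c := by
  set m := φ 0 ^ 2 + ψ 0 ^ 2 with hm
  have hmpos : 0 < m := by rcases hn with h | h <;> positivity
  obtain ⟨φ₂, ψ₂, h₂, h3, h4⟩ := exists_isSol hQ hp (-ψ 0 / m) (φ 0 / m)
  have hw : ∀ x, φ x * ψ₂ x - φ₂ x * ψ x = 1 := by
    intro x
    rw [h.wronskian_eq h₂ x 0, h3, h4]
    field_simp
    rw [hm]; ring
  have hw0 := hw 0
  have hw1 := hw 1
  have hs0 := hs 0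
  rw [zero_add] at hs0
  rw [hs0.1, hs0.2] at hw1
  set c := ε * (φ₂ 1 * ψ₂ 0 - φ₂ 0 * ψ₂ 1) with hc
  refine ⟨φ₂, ψ₂, c, h, h₂, hε, hw, hs, ?_⟩
  have := (h₂.shift hp).ext_of_initial hQ hp (h₂.lincomb h ε (ε * c)) (x₀ := 0)
    (by
      simp only [zero_add, hc]
      linear_combination (φ₂ 0 * φ₂ 1 * ψ 0 - φ 0 * ψ₂ 0 * φ₂ 1) * hε - φ₂ 1 * hw0
        + ε * φ₂ 0 * hw1)
    (by
      simp only [zero_add, hc]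
      linear_combination (φ₂ 0 * ψ 0 * ψ₂ 1 - ψ₂ 0 * ψ₂ 1 * φ 0) * hε - ψ₂ 1 * hw0
        + ε * ψ₂ 0 * hw1)
  intro x
  obtain ⟨h1, h2⟩ := this x
  exact ⟨by linarith, by linarith⟩

namespace IsParabolic

variable {Q W φ ψ φ₂ ψ₂ : ℝ → ℝ} {ε c s : ℝ}

theorem ne_zero (h : IsParabolic Q φ ψ φ₂ ψ₂ ε c) (x : ℝ) : φ x ≠ 0 ∨ ψ x ≠ 0 := by
  by_contra! h0
  have := h.wronskian x
  rw [h0.1, h0.2] at this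
  simp at this

theorem ne_zero₂ (h : IsParabolic Q φ ψ φ₂ ψ₂ ε c) (x : ℝ) : φ₂ x ≠ 0 ∨ ψ₂ x ≠ 0 := by
  by_contra! h0
  have := h.wronskian x
  rw [h0.1, h0.2] at this
  simp at this

/-- The period map, in terms of the coordinate along `φ₂`. -/
theorem shift (h : IsParabolic Q φ ψ φ₂ ψ₂ ε c) (hQ : Continuous Q) (hp : ∀ x, Q (x + 1) = Q x)
    {y z : ℝ → ℝ} (hy : IsSol Q y z) :
    y 1 = ε * (y 0 + c * (φ 0 * z 0 - y 0 * ψ 0) * φ 0) ∧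
      z 1 = ε * (z 0 + c * (φ 0 * z 0 - y 0 * ψ 0) * ψ 0) := by
  have hw := h.wronskian 0
  have h1 := h.shift₁ 0
  have h2 := h.shift₂ 0
  simp only [zero_add] at h1 h2
  obtain ⟨e1, e2⟩ := hy.ext_of_initial hQ hp (h.sol₁.lincomb h.sol₂
    (y 0 * ψ₂ 0 - φ₂ 0 * z 0) (φ 0 * z 0 - y 0 * ψ 0)) (x₀ := 0)
    (by linear_combination -(y 0) * hw) (by linear_combination -(z 0) * hw) 1
  rw [e1, e2, h1.1, h1.2, h2.1, h2.2]
  constructor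
  · linear_combination (ε * y 0) * hw
  · linear_combination (ε * z 0) * hw

theorem trace_eq (h : IsParabolic Q φ ψ φ₂ ψ₂ ε c) (hQ : Continuous Q)
    (hp : ∀ x, Q (x + 1) = Q x) {u u' v v' : ℝ → ℝ} (hf : IsFund Q u u' v v') :
    u 1 + v' 1 = 2 * ε := by
  have h1 := (h.shift hQ hp hf.solC).1
  have h2 := (h.shift hQ hp hf.solS).2
  rw [h1, h2, hf.c_zero, hf.c'_zero, hf.s_zero, hf.s'_zero]
  ring

/-- A small perturbation of the sign of the Jordan coefficient makes the period map elliptic. -/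
theorem abs_trace_lt (h : IsParabolic Q φ ψ φ₂ ψ₂ ε c) (hQ : Continuous Q)
    (hp : ∀ x, Q (x + 1) = Q x) (hWp : ∀ x, W (x + 1) = W x) {κ B η : ℝ}
    (hS : IsSmallPerturbation Q W κ B η) (hc : 0 ≤ s * c) (hW0 : ∀ x, 0 ≤ s * W x)
    (hW : ∀ x, φ x ≠ 0 → 0 < s * W x) {u u' v v' : ℝ → ℝ}
    (hf : IsFund (fun x => Q x - W x) u u' v v') : |u 1 + v' 1| < 2 := by
  by_contra hcon
  obtain ⟨lam, y, z, hy, hn, hyp⟩ := hf.exists_real_floquet (hQ.sub hS.continuous)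
    (fun x => by simp only [hp, hWp]) (not_lt.1 hcon)
  exact hS.no_real_floquet h.sol₁ h.ne_zero h.sq_eq_one h.shift₁ h.sol₂ h.wronskian h.shift₂ hc
    hW0 hW hy hn hyp

end IsParabolic

/-- For a fixed potential no uniformity in the frequency is needed, so `κ = 1` is enough. -/
theorem exists_isSmallPerturbation {Q : ℝ → ℝ} (hQ : Continuous Q) (hp : ∀ x, Q (x + 1) = Q x) :
    ∃ B η : ℝ, 0 < η ∧ ∀ W : ℝ → ℝ, Continuous W → (∀ x, |W x| ≤ η) →
      IsSmallPerturbation Q W 1 B η := by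
  obtain ⟨B, hB1, hB⟩ := exists_abs_le_of_periodic hQ hp
  have hle : min 1 (Real.exp (-(B + 2 : ℝ)) / 2) ≤ Real.exp (-(B + 2 : ℝ)) / 2 := min_le_right _ _
  refine ⟨B + 2, min 1 (Real.exp (-(B + 2 : ℝ)) / 2), by positivity, fun W hW hWη => ⟨hW, le_rfl,
    fun x => ?_, fun x => ?_, hWη, ?_⟩⟩
  · have := abs_le.1 (hB x)
    rw [abs_le]; constructor <;> linarith
  · have := abs_le.1 (hB x)
    have h2 := abs_le.1 ((hWη x).trans (min_le_left _ _))
    rw [abs_le]; constructor <;> linarith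
  · calc _ ≤ Real.exp (-(B + 2 : ℝ)) / 2 * Real.exp (B + 2) := by gcongr
      _ = 1 / 2 := by
        rw [div_mul_eq_mul_div, ← Real.exp_add]; simp
      _ < 1 := by norm_num

/-! ### Sign of the Jordan coefficient at band edges. -/

section Edges

variable {Q φ ψ φ₂ ψ₂ : ℝ → ℝ} {ε c s : ℝ}

/-- Closeness of the rotation form `y z' - z y'` for nearby potentials. -/
theorem IsSol.exists_rotation_close {y z : ℝ → ℝ} (hQ : Continuous Q)
    (hp : ∀ x, Q (x + 1) = Q x) (h : IsSol Q y z) {δ : ℝ} (hδ : 0 < δ) :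
    ∃ η > 0, ∀ {Q' y' z' : ℝ → ℝ}, (∀ x, |Q' x - Q x| ≤ η) → IsSol Q' y' z' → y' 0 = y 0 →
      z' 0 = z 0 → |(y' 0 * z' 1 - z' 0 * y' 1) - (y 0 * z 1 - z 0 * y 1)| < δ := by
  set m := |y 0| + |z 0| + 1 with hm
  have hmpos : 0 < m := by positivity
  obtain ⟨η, hη, H⟩ := h.exists_close hQ hp (ε := δ / m) (by positivity)
  refine ⟨η, hη, fun {Q' y' z'} hQ' h' e1 e2 => ?_⟩
  obtain ⟨h1, h2⟩ := H hQ' h' e1 e2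
  rw [e1, e2]
  calc |(y 0 * z' 1 - z 0 * y' 1) - (y 0 * z 1 - z 0 * y 1)|
      = |y 0 * (z' 1 - z 1) - z 0 * (y' 1 - y 1)| := by ring_nf
    _ ≤ |y 0| * |z' 1 - z 1| + |z 0| * |y' 1 - y 1| := by
      rw [← abs_mul, ← abs_mul]; exact abs_sub _ _
    _ ≤ |y 0| * (δ / m) + |z 0| * (δ / m) := by gcongr
    _ < m * (δ / m) := by
      have : 0 < δ / m := by positivity
      rw [hm]; nlinarith
    _ = δ := by field_simp

/-- At a band edge, the Jordan coefficient points into the band. -/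
theorem IsParabolic.sign_nonneg (h : IsParabolic Q φ ψ φ₂ ψ₂ ε c) (hQ : Continuous Q)
    (hp : ∀ x, Q (x + 1) = Q x) (hs : s ^ 2 = 1)
    (hband : ∃ e₀ > 0, ∀ e ∈ Ioo (0 : ℝ) e₀, ∃ u u' v v',
      IsFund (fun x => Q x - s * e) u u' v v' ∧ |u 1 + v' 1| < 2) : 0 ≤ s * c := by
  -- Suppose `s c < 0` and move slightly into the band. The period map is then elliptic and rotates
  -- all vectors the same way. But the perturbation turns the vector of `φ` so that `s ε F₁ < 0`,
  -- while for `φ₂` the rotation form stays near `-ε c`, so that `s ε F₂ > 0`.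
  by_contra! hneg
  have hc0 : c ≠ 0 := by rintro rfl; simp at hneg
  obtain ⟨e₀, he₀, hband⟩ := hband
  obtain ⟨B, η₁, hη₁, hS⟩ := exists_isSmallPerturbation hQ hp
  obtain ⟨η₂, hη₂, hcl⟩ := h.sol₂.exists_rotation_close hQ hp (abs_pos.2 hc0)
  have hsabs : |s| = 1 := by rwa [← sq_eq_sq₀ (abs_nonneg _) one_pos.le, sq_abs, one_pow]
  have hεabs : |ε| = 1 := by
    rw [← sq_eq_sq₀ (abs_nonneg _) one_pos.le, sq_abs, one_pow, h.sq_eq_one]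
  set e := min (e₀ / 2) (min η₁ η₂) with he
  have hepos : 0 < e := by positivity
  have hee : e < e₀ := (min_le_left _ _).trans_lt (by linarith)
  have heη₁ : e ≤ η₁ := (min_le_right _ _).trans (min_le_left _ _)
  have heη₂ : e ≤ η₂ := (min_le_right _ _).trans (min_le_right _ _)
  have habs : |s * e| = e := by rw [abs_mul, hsabs, one_mul, abs_of_pos hepos]
  obtain ⟨u, u', v, v', hf, htr⟩ := hband e ⟨hepos, hee⟩
  have hQ' : Continuous fun x => Q x - s * e := by fun_prop
  have hp' : ∀ x, Q (x + 1) - s * e = Q x - s * e := fun x => by rw [hp]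
  obtain ⟨y₁, z₁, hy₁, a1, b1⟩ := exists_isSol hQ' hp' (φ 0) (ψ 0)
  obtain ⟨y₂, z₂, hy₂, a2, b2⟩ := exists_isSol hQ' hp' (φ₂ 0) (ψ₂ 0)
  have hdef := hf.rotation_definite hQ' hp' htr hy₁ hy₂ (by rw [a1, b1]; exact h.ne_zero 0)
    (by rw [a2, b2]; exact h.ne_zero₂ 0)
  have hP : 0 < (1 : ℝ) ^ 2 * (φ 0 * y₁ 0) + ψ 0 * z₁ 0 := by
    rw [a1, b1]
    rcases h.ne_zero 0 with h | h
    · have := mul_self_pos.2 h; nlinarith [mul_self_nonneg (ψ 0)]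
    · have := mul_self_pos.2 h; nlinarith [mul_self_nonneg (φ 0)]
  have hneg₁ := (hS (fun _ => s * e) continuous_const (fun _ => habs.trans_le heη₁)).wronskian_neg
    (s := s) (x₀ := 0) h.sol₁ hy₁ (fun x _ => by
      rw [← mul_assoc, ← sq, hs, one_mul]; exact hepos) (by rw [a1, b1]; ring) hP
  obtain ⟨p1, p2⟩ := h.shift₁ 0
  rw [p1, p2, zero_add, ← a1, ← b1] at hneg₁
  have hcl₂ := hcl (Q' := fun x => Q x - s * e) (fun x => by
    rw [sub_sub_cancel_left, abs_neg, habs]; exact heη₂) hy₂ a2 b2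
  have hF : φ₂ 0 * ψ₂ 1 - ψ₂ 0 * φ₂ 1 = -(ε * c) := by
    obtain ⟨q1, q2⟩ := h.shift₂ 0
    rw [zero_add] at q1 q2
    rw [q1, q2]
    linear_combination (-ε * c) * h.wronskian 0
  rw [hF] at hcl₂
  set F₁ := y₁ 0 * z₁ 1 - z₁ 0 * y₁ 1
  set F₂ := y₂ 0 * z₂ 1 - z₂ 0 * y₂ 1
  have h1 : s * ε * F₁ < 0 := by
    have : s * (ε * y₁ 0 * z₁ 1 - y₁ 1 * (ε * z₁ 0)) = s * ε * F₁ := by simp only [F₁]; ring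
    rwa [this] at hneg₁
  have h2 : 0 < s * ε * F₂ := by
    have h3 : |s * ε * (F₂ - -(ε * c))| < |s * c| := by
      rw [abs_mul, abs_mul, hsabs, hεabs, abs_mul, hsabs, one_mul, one_mul, one_mul]
      exact hcl₂
    rw [abs_of_neg hneg] at h3
    have h4 : s * ε * (F₂ - -(ε * c)) = s * ε * F₂ + s * c := by
      linear_combination (s * c) * h.sq_eq_one
    rw [h4] at h3
    linarith [(abs_lt.1 h3).1]
  have h3 := mul_neg_of_neg_of_pos h1 h2
  have h4 : s * ε * F₁ * (s * ε * F₂) = F₁ * F₂ := by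
    linear_combination (ε ^ 2 * F₁ * F₂) * hs + (F₁ * F₂) * h.sq_eq_one
  linarith

/-- If the band edge borders an open gap, the Jordan block is not diagonal. -/
theorem IsParabolic.coeff_ne_zero (h : IsParabolic Q φ ψ φ₂ ψ₂ ε c) (hQ : Continuous Q)
    (hp : ∀ x, Q (x + 1) = Q x) (hs : s ^ 2 = 1)
    (hgap : ∃ e₀ > 0, ∀ e ∈ Ioo (0 : ℝ) e₀, ∃ u u' v v',
      IsFund (fun x => Q x - s * e) u u' v v' ∧ 2 < |u 1 + v' 1|) : c ≠ 0 := by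
  rintro rfl
  obtain ⟨e₀, he₀, hgap⟩ := hgap
  obtain ⟨B, η₁, hη₁, hS⟩ := exists_isSmallPerturbation hQ hp
  have hsabs : |s| = 1 := by rwa [← sq_eq_sq₀ (abs_nonneg _) one_pos.le, sq_abs, one_pow]
  set e := min (e₀ / 2) η₁ with he
  have hepos : 0 < e := by positivity
  have hee : e < e₀ := (min_le_left _ _).trans_lt (by linarith)
  have habs : |s * e| = e := by rw [abs_mul, hsabs, one_mul, abs_of_pos hepos]
  obtain ⟨u, u', v, v', hf, htr⟩ := hgap e ⟨hepos, hee⟩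
  have hQ' : Continuous fun x => Q x - s * e := by fun_prop
  have hp' : ∀ x, Q (x + 1) - s * e = Q x - s * e := fun x => by rw [hp]
  obtain ⟨lam, y, z, hy, hn, hyp⟩ := hf.exists_real_floquet hQ' hp' htr.le
  -- With `c = 0` the unperturbed period map is `ε` times the identity, so `f` and the Floquet
  -- solution `y`, equal at `0`, are again parallel at `1`. The comparison lemma forbids this.
  obtain ⟨f, g, hfg, a, b⟩ := exists_isSol hQ hp (y 0) (z 0)
  have hsm := hS (fun _ => s * e) continuous_const (fun _ => habs.trans_le (min_le_right _ _))
  refine hsm.wronskian_ne_zero (s := s) (x₀ := 0) hfg hy (fun x _ => by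
      rw [← mul_assoc, ← sq, hs, one_mul]; exact hepos) (by rwa [a, b]) hn (by rw [a, b]; ring) ?_
  obtain ⟨e1, e2⟩ := h.shift hQ hp hfg
  rw [(hyp 0).1, (hyp 0).2, zero_add, e1, e2, a, b]
  ring

/-- The sign of a nonzero Jordan coefficient is stable. -/
theorem IsParabolic.sign_stable (h : IsParabolic Q φ ψ φ₂ ψ₂ ε c) (hQ : Continuous Q)
    (hp : ∀ x, Q (x + 1) = Q x) (hs : s ^ 2 = 1) (hsc : 0 < s * c) :
    ∃ η > 0, ∀ {Q' φ' ψ' φ₂' ψ₂' : ℝ → ℝ} {ε' c' : ℝ}, Continuous Q' →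
      (∀ x, Q' (x + 1) = Q' x) → (∀ x, |Q' x - Q x| ≤ η) →
      IsParabolic Q' φ' ψ' φ₂' ψ₂' ε' c' → 0 < s * c' := by
  have hc0 : c ≠ 0 := by rintro rfl; simp at hsc
  have hsabs : |s| = 1 := by rwa [← sq_eq_sq₀ (abs_nonneg _) one_pos.le, sq_abs, one_pow]
  obtain ⟨u, u', v, v', hf⟩ := exists_isFund hQ hp
  obtain ⟨η₁, hη₁, H₁⟩ := hf.solC.exists_close hQ hp (ε := 1 / 2) (by norm_num)
  obtain ⟨η₂, hη₂, H₂⟩ := hf.solS.exists_close hQ hp (ε := 1 / 2) (by norm_num)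
  obtain ⟨η₃, hη₃, H₃⟩ := h.sol₂.exists_rotation_close hQ hp (abs_pos.2 hc0)
  refine ⟨min η₁ (min η₂ η₃), by positivity, ?_⟩
  intro Q' φ' ψ' φ₂' ψ₂' ε' c' hQ' hp' hcl h'
  obtain ⟨f, f', g, g', hf'⟩ := exists_isFund hQ' hp'
  have h1 := (H₁ (fun x => (hcl x).trans (min_le_left _ _)) hf'.solC
    (hf'.c_zero.trans hf.c_zero.symm) (hf'.c'_zero.trans hf.c'_zero.symm)).1
  have h2 := (H₂ (fun x => (hcl x).trans ((min_le_right _ _).trans (min_le_left _ _))) hf'.solS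
    (hf'.s_zero.trans hf.s_zero.symm) (hf'.s'_zero.trans hf.s'_zero.symm)).2
  have ht := h.trace_eq hQ hp hf
  have ht' := h'.trace_eq hQ' hp' hf'
  -- Both traces are `±2` and they differ by less than `1`.
  have hεε : ε' = ε := by
    have h3 := abs_lt.1 h1
    have h4 := abs_lt.1 h2
    rcases sq_eq_one_iff.1 h.sq_eq_one with h5 | h5 <;>
    rcases sq_eq_one_iff.1 h'.sq_eq_one with h6 | h6 <;> 
      first | exact h6.trans h5.symm | linarith
  subst hεε
  obtain ⟨y, z, hy, a, b⟩ := exists_isSol hQ' hp' (φ₂ 0) (ψ₂ 0)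
  have h3 := H₃ (fun x => (hcl x).trans ((min_le_right _ _).trans (min_le_right _ _))) hy a b
  have hF : φ₂ 0 * ψ₂ 1 - ψ₂ 0 * φ₂ 1 = -(ε' * c) := by
    obtain ⟨q1, q2⟩ := h.shift₂ 0
    rw [zero_add] at q1 q2
    rw [q1, q2]
    linear_combination (-ε' * c) * h.wronskian 0
  obtain ⟨e1, e2⟩ := h'.shift hQ' hp' hy
  -- Only the sign of a Jordan coefficient is intrinsic. The rotation form at the old data of `φ₂`
  -- equals `-ε' c' w²`, where the square absorbs the choice of the new basis.
  set w := φ' 0 * z 0 - y 0 * ψ' 0 with hw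
  have hF' : y 0 * z 1 - z 0 * y 1 = -(ε' * c' * w ^ 2) := by
    rw [e1, e2, hw]; ring
  rw [hF, hF'] at h3
  have hεabs : |ε'| = 1 := by
    rw [← sq_eq_sq₀ (abs_nonneg _) one_pos.le, sq_abs, one_pow, h.sq_eq_one]
  have h5 : |s * ε' * (-(ε' * c' * w ^ 2) - -(ε' * c))| < |s * c| := by
    rw [abs_mul, abs_mul, hsabs, hεabs, abs_mul, hsabs, one_mul, one_mul, one_mul]
    exact h3
  rw [abs_of_pos hsc] at h5
  have h4 : s * ε' * (-(ε' * c' * w ^ 2) - -(ε' * c)) = -(s * c' * w ^ 2) + s * c := by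
    linear_combination (s * c - s * c' * w ^ 2) * h.sq_eq_one
  rw [h4] at h5
  have h6 : 0 < s * c' * w ^ 2 := by linarith [(abs_lt.1 h5).2]
  exact pos_of_mul_pos_left h6 (sq_nonneg _)

/-- A periodic potential with a nontrivial periodic or antiperiodic solution is nonpositive
somewhere. -/
theorem IsSol.exists_nonpos (h : IsSol Q φ ψ) (hn : ∀ x, φ x ≠ 0 ∨ ψ x ≠ 0) (hε : ε ^ 2 = 1)
    (hs : ∀ x, φ (x + 1) = ε * φ x ∧ ψ (x + 1) = ε * ψ x) : ∃ x, Q x ≤ 0 := by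
  by_contra! hpos
  -- The product `φ ψ` is periodic because `ε² = 1`, so it cannot be strictly increasing.
  have hd : ∀ x, HasDerivAt (fun x => φ x * ψ x) (ψ x ^ 2 + Q x * φ x ^ 2) x := fun x =>
    ((h.deriv₁ x).mul (h.deriv₂ x)).congr_deriv (by ring)
  have hmono : StrictMono fun x => φ x * ψ x := by
    refine strictMono_of_deriv_pos fun x => ?_
    rw [(hd x).deriv]
    have hQx := hpos x
    by_contra hcon
    have h1 : φ x = 0 := by
      by_contra h0
      have : 0 < Q x * φ x ^ 2 := by positivity
      nlinarith [sq_nonneg (ψ x)]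
    have h2 : ψ x = 0 := by
      by_contra h0
      have : 0 < ψ x ^ 2 := by positivity
      nlinarith [sq_nonneg (φ x)]
    exact (hn x).elim (fun h => h h1) (fun h => h h2)
  have := hmono (show (0 : ℝ) < 0 + 1 by norm_num)
  simp only [(hs 0).1, (hs 0).2] at this
  have h2 : ε * φ 0 * (ε * ψ 0) = φ 0 * ψ 0 := by linear_combination (φ 0 * ψ 0) * hε
  linarith

end Edges

/-! ### Standing waves and the position of `0` in the spectrum of `L₊`. -/

section StandingWaves

variable {σ ω : ℝ} {V φ : ℝ → ℝ}

theorem IsStandingWave.contDiff (h : IsStandingWave σ V ω φ) : ContDiff ℝ 2 φ := by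
  have h1 := h.1.2.1 0
  simp only [Complex.ofReal_zero, mul_zero, Complex.exp_zero, one_mul] at h1
  exact Complex.reCLM.contDiff.comp h1

theorem IsStandingWave.solvesHill (h : IsStandingWave σ V ω φ) :
    SolvesHill (minusPotential σ V ω φ) 0 φ := by
  have hc := h.contDiff
  refine ⟨hc, fun x => ?_⟩
  have h1 := h.1.2.2 0 x
  have hd1 : Differentiable ℝ φ := hc.differentiable (by norm_num)
  have hd2 : Differentiable ℝ (deriv φ) :=
    ((contDiff_succ_iff_deriv (n := 1)).1 hc).2.2.differentiable (by norm_num)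
  have hexp : HasDerivAt (fun s : ℝ => Complex.exp (-Complex.I * ω * s) * (φ x : ℂ))
      (-Complex.I * ω * φ x) 0 := by
    have h2 : HasDerivAt (fun s : ℝ => -Complex.I * ω * (s : ℂ)) (-Complex.I * ω) 0 := by
      simpa using (Complex.ofRealCLM.hasDerivAt (x := (0 : ℝ))).const_mul (-Complex.I * ω)
    have h3 := h2.cexp.mul_const (φ x : ℂ)
    simpa using h3
  rw [hexp.deriv] at h1
  simp only [Complex.ofReal_zero, mul_zero, Complex.exp_zero, one_mul] at h1
  have hit : iteratedDeriv 2 (fun x => (φ x : ℂ)) x = ((iteratedDeriv 2 φ x : ℝ) : ℂ) := by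
    have e1 : deriv (fun x => (φ x : ℂ)) = fun x => ((deriv φ x : ℝ) : ℂ) :=
      funext fun x => ((hd1 x).hasDerivAt.ofReal_comp).deriv
    rw [iteratedDeriv_succ, iteratedDeriv_one, iteratedDeriv_succ, iteratedDeriv_one, e1]
    exact ((hd2 x).hasDerivAt.ofReal_comp).deriv
  rw [hit, Complex.norm_real, Real.norm_eq_abs, sq_abs] at h1
  have h2 : ω * φ x = -(1 / 2) * iteratedDeriv 2 φ x + σ * φ x ^ 2 * φ x + V x * φ x := by
    have h3 : Complex.I * (-Complex.I * ω * φ x) = ((ω * φ x : ℝ) : ℂ) := by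
      push_cast; linear_combination (-(ω : ℂ) * φ x) * Complex.I_mul_I
    rw [h3] at h1
    apply Complex.ofReal_injective
    rw [h1]
    push_cast
    ring
  simp only [minusPotential]
  linear_combination -h2

theorem continuous_minusPotential (hV : Continuous V) (hφ : Continuous φ) :
    Continuous (minusPotential σ V ω φ) := by
  unfold minusPotential; fun_prop

theorem continuous_plusPotential (hV : Continuous V) (hφ : Continuous φ) :
    Continuous (plusPotential σ V ω φ) := by
  unfold plusPotential; fun_prop

theorem IsStandingWave.exists_sign (h : IsStandingWave σ V ω φ) :
    ∃ ε : ℝ, ε ^ 2 = 1 ∧ ∀ x, φ (x + 1) = ε * φ x := by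
  rcases h.2.1 with h | h
  · exact ⟨1, by norm_num, fun x => by rw [h, one_mul]⟩
  · exact ⟨-1, by norm_num, fun x => by rw [h, neg_one_mul]⟩

theorem IsStandingWave.sq_periodic (h : IsStandingWave σ V ω φ) (x : ℝ) :
    φ (x + 1) ^ 2 = φ x ^ 2 := by
  obtain ⟨ε, hε, hs⟩ := h.exists_sign
  rw [hs, mul_pow, hε, one_mul]

theorem IsStandingWave.minusPotential_periodic (h : IsStandingWave σ V ω φ)
    (hVp : ∀ x, V (x + 1) = V x) (x : ℝ) :
    minusPotential σ V ω φ (x + 1) = minusPotential σ V ω φ x := by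
  simp only [minusPotential, hVp, h.sq_periodic]

theorem IsStandingWave.plusPotential_periodic (h : IsStandingWave σ V ω φ)
    (hVp : ∀ x, V (x + 1) = V x) (x : ℝ) :
    plusPotential σ V ω φ (x + 1) = plusPotential σ V ω φ x := by
  simp only [plusPotential, hVp, h.sq_periodic]

/-- The profile of a standing wave makes the period map of `L₋` parabolic. -/
theorem IsStandingWave.exists_isParabolic (h : IsStandingWave σ V ω φ) (hV : Continuous V)
    (hVp : ∀ x, V (x + 1) = V x) : ∃ ψ φ₂ ψ₂ ε c,
      IsParabolic (fun x => 2 * (minusPotential σ V ω φ x - 0)) φ ψ φ₂ ψ₂ ε c := by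
  have hqc := continuous_minusPotential (σ := σ) (ω := ω) hV h.contDiff.continuous
  have hqp := h.minusPotential_periodic hVp
  have hQc : Continuous (fun x => 2 * (minusPotential σ V ω φ x - 0)) := by fun_prop
  have hQp : ∀ x, 2 * (minusPotential σ V ω φ (x + 1) - 0) =
      2 * (minusPotential σ V ω φ x - 0) := fun x => by rw [hqp]
  have hsol := (solvesHill_iff hqc).1 h.solvesHill
  obtain ⟨ε, hε, hs⟩ := h.exists_sign
  have hs' : ∀ x, deriv φ (x + 1) = ε * deriv φ x := by
    intro x
    have h1 := (hsol.deriv₁ (x + 1)).comp_add_const x 1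
    have h2 := (hsol.deriv₁ x).const_mul ε
    rw [← funext hs] at h2
    exact h1.unique h2
  have hn : φ 0 ≠ 0 ∨ deriv φ 0 ≠ 0 := by
    by_contra! h0
    obtain ⟨x, hx⟩ := h.2.2
    have := hsol.ext_of_initial hQc hQp (hsol.smul 0) (x₀ := 0) (by simp [h0.1]) (by simp [h0.2]) x
    simp at this
    exact hx this.1
  obtain ⟨φ₂, ψ₂, c, hpar⟩ := hsol.exists_isParabolic hQc hQp hn hε fun x => ⟨hs x, hs' x⟩
  exact ⟨_, φ₂, ψ₂, ε, c, hpar⟩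

theorem inBandInterior_iff {q : ℝ → ℝ} (hq : Continuous q) {E : ℝ} :
    InBandInterior q E ↔ ∃ c c' s s', IsFund (fun x => 2 * (q x - E)) c c' s s' ∧
      |c 1 + s' 1| < 2 := by
  simp only [InBandInterior, isDiscriminant_iff hq]
  grind

theorem inGap_iff {q : ℝ → ℝ} (hq : Continuous q) {E : ℝ} :
    InGap q E ↔ ∃ c c' s s', IsFund (fun x => 2 * (q x - E)) c c' s s' ∧
      2 < |c 1 + s' 1| := by
  simp only [InGap, isDiscriminant_iff hq]
  grind

/-- For waves of small amplitude whose Jordan coefficient has the right sign, zero is in the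
interior of a band of `L₊`. -/
theorem exists_amplitude_bound (K : ℝ) : ∃ δ > 0, ∀ V : ℝ → ℝ, Continuous V →
    (∀ x, V (x + 1) = V x) → (∀ x, |V x| ≤ K) → ∀ (σ ω : ℝ) (φ ψ φ₂ ψ₂ : ℝ → ℝ) (ε c : ℝ),
      σ ^ 2 = 1 → (∀ x, |φ x| < δ) → IsStandingWave σ V ω φ →
      IsParabolic (fun x => 2 * (minusPotential σ V ω φ x - 0)) φ ψ φ₂ ψ₂ ε c →
      0 ≤ -σ * c → InBandInterior (plusPotential σ V ω φ) 0 := by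
  -- With `|V| ≤ K` and `φ² ≤ 1` the potentials shifted by `κ²` below stay within `4K + 9`. The
  -- factor `1/8` gives `4 δ e^B ≤ 1/2`.
  set B := 4 * K + 12 with hB
  set δ := min 1 (Real.exp (-B) / 8) with hδ
  have hδpos : 0 < δ := by positivity
  refine ⟨δ, hδpos, ?_⟩
  intro V hV hVp hK σ ω φ ψ φ₂ ψ₂ ε c hσ hφ hw hpar hc
  have hK0 : 0 ≤ K := (abs_nonneg _).trans (hK 0)
  have hδ1 : δ ≤ 1 := min_le_left _ _
  have hφ2 : ∀ x, φ x ^ 2 < δ := by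
    intro x
    have h1 := hφ x
    rw [← sq_abs]
    nlinarith [abs_nonneg (φ x)]
  have hσabs : |σ| = 1 := by rwa [← sq_eq_sq₀ (abs_nonneg _) one_pos.le, sq_abs, one_pow]
  have hσφ : ∀ x, |σ * φ x ^ 2| ≤ δ := fun x => by
    rw [abs_mul, hσabs, one_mul, abs_of_nonneg (sq_nonneg _)]; exact (hφ2 x).le
  have hφc := hw.contDiff.continuous
  have hqc := continuous_minusPotential (σ := σ) (ω := ω) hV hφc
  have hqp := hw.minusPotential_periodic hVp
  have hQc : Continuous (fun x => 2 * (minusPotential σ V ω φ x - 0)) := by fun_prop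
  have hQp : ∀ x, 2 * (minusPotential σ V ω φ (x + 1) - 0) =
      2 * (minusPotential σ V ω φ x - 0) := fun x => by rw [hqp]
  obtain ⟨x₁, hx₁⟩ := hpar.sol₁.exists_nonpos hpar.ne_zero hpar.sq_eq_one hpar.shift₁
  have hωK : 0 ≤ ω + K + 1 := by
    simp only [minusPotential] at hx₁
    linarith [(abs_le.1 (hK x₁)).1, (abs_le.1 (hσφ x₁)).1]
  -- The term `2ω` cancels the frequency in `Q`, which frees `B` from `ω`. That `κ ≥ 1` rests on the
  -- lower bound `ω ≥ -K - 1`, which holds since the potential of `L₋` is nonpositive somewhere.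
  set κ := Real.sqrt (2 * ω + 2 * K + 3) with hκ
  have hκ2 : κ ^ 2 = 2 * ω + 2 * K + 3 := Real.sq_sqrt (by linarith)
  have hκ1 : 1 ≤ κ := by rw [hκ, Real.one_le_sqrt]; linarith
  -- The difference `2σφ²` of the potentials is doubled by `Q = 2(q - E)` and negated by the form `Q
  -- - W`. With `s = -σ` this gives `s W = 4φ²`.
  set W : ℝ → ℝ := fun x => -4 * σ * φ x ^ 2 with hW
  have hWabs : ∀ x, |W x| ≤ 4 * δ := by
    intro x
    have h1 := abs_le.1 (hσφ x)
    rw [abs_le]; simp only [hW]; constructor <;> linarith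
  have hS : IsSmallPerturbation (fun x => 2 * (minusPotential σ V ω φ x - 0)) W κ B (4 * δ) := by
    refine ⟨by fun_prop, hκ1, fun x => ?_, fun x => ?_, hWabs, ?_⟩
    · have h1 := abs_le.1 (hσφ x)
      have h2 := abs_le.1 (hK x)
      simp only [minusPotential]
      rw [hκ2, abs_le]; constructor <;> linarith
    · have h1 := abs_le.1 (hσφ x)
      have h2 := abs_le.1 (hK x)
      have h3 := abs_le.1 (hWabs x)
      simp only [minusPotential]
      rw [hκ2, abs_le]; constructor <;> linarith
    · have h1 : δ ≤ Real.exp (-B) / 8 := min_le_right _ _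
      calc 4 * δ * Real.exp B ≤ 4 * (Real.exp (-B) / 8) * Real.exp B := by gcongr
        _ = 1 / 2 * (Real.exp (-B) * Real.exp B) := by ring
        _ < 1 := by rw [← Real.exp_add]; norm_num
  have hsW : ∀ x, -σ * W x = 4 * φ x ^ 2 := fun x => by
    simp only [hW]; linear_combination (4 * φ x ^ 2) * hσ
  have hWp : ∀ x, W (x + 1) = W x := fun x => by simp only [hW, hw.sq_periodic]
  have hplus : (fun x => 2 * (plusPotential σ V ω φ x - 0)) =
      fun x => 2 * (minusPotential σ V ω φ x - 0) - W x := by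
    funext x; simp only [plusPotential, minusPotential, hW]; ring
  rw [inBandInterior_iff (continuous_plusPotential hV hφc), hplus]
  obtain ⟨u, u', v, v', hf⟩ := exists_isFund (Q := fun x => 2 * (minusPotential σ V ω φ x - 0) - W x)
    (hQc.sub hS.continuous) (fun x => by simp only [hqp, hWp])
  exact ⟨u, u', v, v', hf, hpar.abs_trace_lt hQc hQp hWp hS hc
    (fun x => by rw [hsW]; positivity) (fun x hx => by rw [hsW]; positivity) hf⟩

end StandingWaves

/-! ### Band edges in terms of period maps. -/

section BandEdges

variable {q : ℝ → ℝ} {E : ℝ}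

/-- A shift of `Q = 2(q - E)` by `e` is an energy shift by `e / 2`. The factor `1`, or `-1` in the
companions, is the sign `s` of the comparison lemmas. -/
theorem IsLowerBandEdge.exists_isFund (hq : Continuous q) (h : IsLowerBandEdge q E) :
    ∃ e₀ > 0, ∀ e ∈ Ioo (0 : ℝ) e₀, ∃ u u' v v',
      IsFund (fun x => 2 * (q x - E) - 1 * e) u u' v v' ∧ |u 1 + v' 1| < 2 := by
  obtain ⟨-, ε, hε, hb⟩ := h
  refine ⟨2 * ε, by positivity, fun e he => ?_⟩
  have := (inBandInterior_iff hq).1 (hb (E + e / 2) ⟨by linarith [he.1], by linarith [he.2]⟩)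
  have hfun : (fun x => 2 * (q x - (E + e / 2))) = fun x => 2 * (q x - E) - 1 * e := by
    funext x; ring
  rwa [hfun] at this

theorem IsUpperBandEdge.exists_isFund (hq : Continuous q) (h : IsUpperBandEdge q E) :
    ∃ e₀ > 0, ∀ e ∈ Ioo (0 : ℝ) e₀, ∃ u u' v v',
      IsFund (fun x => 2 * (q x - E) - (-1) * e) u u' v v' ∧ |u 1 + v' 1| < 2 := by
  obtain ⟨-, ε, hε, hb⟩ := h
  refine ⟨2 * ε, by positivity, fun e he => ?_⟩
  have := (inBandInterior_iff hq).1 (hb (E - e / 2) ⟨by linarith [he.2], by linarith [he.1]⟩)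
  have hfun : (fun x => 2 * (q x - (E - e / 2))) = fun x => 2 * (q x - E) - (-1) * e := by
    funext x; ring
  rwa [hfun] at this

theorem IsLowerBandEdgeAtGap.exists_isFund (hq : Continuous q) (h : IsLowerBandEdgeAtGap q E) :
    ∃ e₀ > 0, ∀ e ∈ Ioo (0 : ℝ) e₀, ∃ u u' v v',
      IsFund (fun x => 2 * (q x - E) - (-1) * e) u u' v v' ∧ 2 < |u 1 + v' 1| := by
  obtain ⟨-, ε, hε, hb⟩ := h
  refine ⟨2 * ε, by positivity, fun e he => ?_⟩
  have := (inGap_iff hq).1 (hb (E - e / 2) ⟨by linarith [he.2], by linarith [he.1]⟩)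
  have hfun : (fun x => 2 * (q x - (E - e / 2))) = fun x => 2 * (q x - E) - (-1) * e := by
    funext x; ring
  rwa [hfun] at this

theorem IsUpperBandEdgeAtGap.exists_isFund (hq : Continuous q) (h : IsUpperBandEdgeAtGap q E) :
    ∃ e₀ > 0, ∀ e ∈ Ioo (0 : ℝ) e₀, ∃ u u' v v',
      IsFund (fun x => 2 * (q x - E) - 1 * e) u u' v v' ∧ 2 < |u 1 + v' 1| := by
  obtain ⟨-, ε, hε, hb⟩ := h
  refine ⟨2 * ε, by positivity, fun e he => ?_⟩
  have := (inGap_iff hq).1 (hb (E + e / 2) ⟨by linarith [he.1], by linarith [he.2]⟩)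
  have hfun : (fun x => 2 * (q x - (E + e / 2))) = fun x => 2 * (q x - E) - 1 * e := by
    funext x; ring
  rwa [hfun] at this

/-- At `|D| = 2` the number `D / 2 = ±1` is the double root of `λ² - D λ + 1`. -/
theorem exists_isParabolic_of_isDiscriminant (hq : Continuous q) (hp : ∀ x, q (x + 1) = q x)
    (h : ∃ D, IsDiscriminant q E D ∧ |D| = 2) :
    ∃ φ ψ φ₂ ψ₂ ε c, IsParabolic (fun x => 2 * (q x - E)) φ ψ φ₂ ψ₂ ε c := by
  obtain ⟨D, hD, hD2⟩ := h
  obtain ⟨u, u', v, v', hf, rfl⟩ := (isDiscriminant_iff hq).1 hD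
  have hQc : Continuous (fun x => 2 * (q x - E)) := by fun_prop
  have hQp : ∀ x, 2 * (q (x + 1) - E) = 2 * (q x - E) := fun x => by rw [hp]
  have hsq : ((u 1 + v' 1) / 2) ^ 2 = 1 := by
    rw [div_pow, ← sq_abs, hD2]; norm_num
  obtain ⟨φ, ψ, hφ, hn, hs⟩ := hf.exists_floquet_of_eigenvalue hQc hQp
    (lam := (u 1 + v' 1) / 2) (by linear_combination -hsq)
  obtain ⟨φ₂, ψ₂, c, h⟩ := hφ.exists_isParabolic hQc hQp hn hsq hs
  exact ⟨φ, ψ, φ₂, ψ₂, _, c, h⟩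

end BandEdges

/-- Waves at a band edge of `L₋`. -/
theorem exists_inBandInterior_of_edge (K : ℝ) : ∃ δ > 0, ∀ V : ℝ → ℝ, Continuous V →
    (∀ x, V (x + 1) = V x) → (∀ x, |V x| ≤ K) → ∀ (ω : ℝ) (φ : ℝ → ℝ), (∀ x, |φ x| < δ) →
      (IsStandingWave (-1) V ω φ → IsLowerBandEdge (minusPotential (-1) V ω φ) 0 →
        InBandInterior (plusPotential (-1) V ω φ) 0) ∧
      (IsStandingWave 1 V ω φ → IsUpperBandEdge (minusPotential 1 V ω φ) 0 →
        InBandInterior (plusPotential 1 V ω φ) 0) := by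
  obtain ⟨δ, hδ, H⟩ := exists_amplitude_bound K
  refine ⟨δ, hδ, fun V hV hVp hK ω φ hφ => ⟨fun hw hedge => ?_, fun hw hedge => ?_⟩⟩
  · obtain ⟨ψ, φ₂, ψ₂, ε, c, hpar⟩ := hw.exists_isParabolic hV hVp
    have hqc := continuous_minusPotential (σ := -1) (ω := ω) hV hw.contDiff.continuous
    refine H V hV hVp hK (-1) ω φ ψ φ₂ ψ₂ ε c (by norm_num) hφ hw hpar ?_
    have := hpar.sign_nonneg (s := 1) (by fun_prop)
      (fun x => by simp only [hw.minusPotential_periodic hVp]) (by norm_num)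
      (hedge.exists_isFund hqc)
    linarith
  · obtain ⟨ψ, φ₂, ψ₂, ε, c, hpar⟩ := hw.exists_isParabolic hV hVp
    have hqc := continuous_minusPotential (σ := 1) (ω := ω) hV hw.contDiff.continuous
    refine H V hV hVp hK 1 ω φ ψ φ₂ ψ₂ ε c (by norm_num) hφ hw hpar ?_
    exact hpar.sign_nonneg (s := -1) (by fun_prop)
      (fun x => by simp only [hw.minusPotential_periodic hVp]) (by norm_num)
      (hedge.exists_isFund hqc)

/-- The potential of `L₋` differs from that of the linear problem by `σφ² + E - ω`, so for small `δ`
the wave inherits the sign of the linear Jordan coefficient. No edge property of `L₋` itself has to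
be known. -/
theorem exists_inBandInterior_of_sign {V : ℝ → ℝ} (hV : Continuous V)
    (hVp : ∀ x, V (x + 1) = V x) {E σ c ε : ℝ} (hσ : σ ^ 2 = 1) {φ₀ ψ₀ φ₂ ψ₂ : ℝ → ℝ}
    (h₀ : IsParabolic (fun x => 2 * (V x - E)) φ₀ ψ₀ φ₂ ψ₂ ε c) (hc : 0 < -σ * c) :
    ∃ δ > 0, ∀ (ω : ℝ) (φ : ℝ → ℝ), |ω - E| < δ → (∀ x, |φ x| < δ) →
      IsStandingWave σ V ω φ → InBandInterior (plusPotential σ V ω φ) 0 := by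
  obtain ⟨K, -, hK⟩ := exists_abs_le_of_periodic hV hVp
  obtain ⟨δ₁, hδ₁, H₁⟩ := exists_amplitude_bound K
  obtain ⟨η, hη, H₂⟩ := h₀.sign_stable (s := -σ) (by fun_prop) (fun x => by simp only [hVp])
    (by rw [neg_sq, hσ]) hc
  set δ := min (min 1 δ₁) (η / 4) with hδ
  have hδpos : 0 < δ := by positivity
  have hδ1 : δ ≤ 1 := (min_le_left _ _).trans (min_le_left _ _)
  have hδδ₁ : δ ≤ δ₁ := (min_le_left _ _).trans (min_le_right _ _)
  have hδη : δ ≤ η / 4 := min_le_right _ _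
  refine ⟨δ, hδpos, fun ω φ hω hφ hw => ?_⟩
  obtain ⟨ψ, φ₂', ψ₂', ε', c', hpar⟩ := hw.exists_isParabolic hV hVp
  have hqc := continuous_minusPotential (σ := σ) (ω := ω) hV hw.contDiff.continuous
  have hσabs : |σ| = 1 := by rwa [← sq_eq_sq₀ (abs_nonneg _) one_pos.le, sq_abs, one_pow]
  have hsc := H₂ (by fun_prop) (fun x => by simp only [hw.minusPotential_periodic hVp])
    (fun x => by
      have h1 : |σ * φ x ^ 2| ≤ δ := by
        rw [abs_mul, hσabs, one_mul, abs_of_nonneg (sq_nonneg _), ← sq_abs]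
        nlinarith [hφ x, abs_nonneg (φ x)]
      have h2 := abs_le.1 h1
      have h3 := abs_lt.1 hω
      simp only [minusPotential]
      rw [abs_le]; constructor <;> linarith) hpar
  exact H₁ V hV hVp hK σ ω φ ψ φ₂' ψ₂' ε' c' hσ (fun x => (hφ x).trans_le hδδ₁) hw hpar hsc.le

/-- Waves bifurcating from a lower band edge of the linear problem. -/
theorem IsLowerBandEdgeAtGap.exists_inBandInterior {V : ℝ → ℝ} (hV : Continuous V)
    (hVp : ∀ x, V (x + 1) = V x) {E : ℝ} (h : IsLowerBandEdgeAtGap V E) :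
    ∃ δ > 0, ∀ (ω : ℝ) (φ : ℝ → ℝ), |ω - E| < δ → (∀ x, |φ x| < δ) →
      IsStandingWave (-1) V ω φ → InBandInterior (plusPotential (-1) V ω φ) 0 := by
  obtain ⟨φ₀, ψ₀, φ₂, ψ₂, ε, c, h₀⟩ := exists_isParabolic_of_isDiscriminant hV hVp h.1.1
  have h1 := h₀.sign_nonneg (s := 1) (by fun_prop) (fun x => by simp only [hVp]) (by norm_num)
    (h.1.exists_isFund hV)
  have h2 := h₀.coeff_ne_zero (s := -1) (by fun_prop) (fun x => by simp only [hVp]) (by norm_num)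
    (h.exists_isFund hV)
  rw [one_mul] at h1
  have h3 := h1.lt_of_ne h2.symm
  exact exists_inBandInterior_of_sign hV hVp (by norm_num) h₀ (by linarith)

/-- Waves bifurcating from an upper band edge of the linear problem. -/
theorem IsUpperBandEdgeAtGap.exists_inBandInterior {V : ℝ → ℝ} (hV : Continuous V)
    (hVp : ∀ x, V (x + 1) = V x) {E : ℝ} (h : IsUpperBandEdgeAtGap V E) :
    ∃ δ > 0, ∀ (ω : ℝ) (φ : ℝ → ℝ), |ω - E| < δ → (∀ x, |φ x| < δ) →
      IsStandingWave 1 V ω φ → InBandInterior (plusPotential 1 V ω φ) 0 := by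
  obtain ⟨φ₀, ψ₀, φ₂, ψ₂, ε, c, h₀⟩ := exists_isParabolic_of_isDiscriminant hV hVp h.1.1
  have h1 := h₀.sign_nonneg (s := -1) (by fun_prop) (fun x => by simp only [hVp]) (by norm_num)
    (h.1.exists_isFund hV)
  have h2 := h₀.coeff_ne_zero (s := 1) (by fun_prop) (fun x => by simp only [hVp]) (by norm_num)
    (h.exists_isFund hV)
  have h3 : 0 < -1 * c := h1.lt_of_ne (by simpa using h2)
  exact exists_inBandInterior_of_sign hV hVp (by norm_num) h₀ h3

/-! ### The real coupled system for imaginary spectral parameter. -/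

/-- The first order vector field of the system `v'' = Q₁ v + t p`, `p'' = Q₂ p - t v`, in the
variables `(v, v', p, p')`. -/
def coupledField (Q₁ Q₂ : ℝ → ℝ) (t x : ℝ) (z : Fin 4 → ℝ) : Fin 4 → ℝ :=
  ![z 1, Q₁ x * z 0 + t * z 2, z 3, Q₂ x * z 2 - t * z 0]

/-- `z = (v, v', p, p')` solves `v'' = Q₁ v + t p`, `p'' = Q₂ p - t v`. -/
def IsCoupledSol (Q₁ Q₂ : ℝ → ℝ) (t : ℝ) (z : ℝ → Fin 4 → ℝ) : Prop :=
  ∀ x, HasDerivAt z (coupledField Q₁ Q₂ t x (z x)) x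

section Coupled

variable {Q₁ Q₂ : ℝ → ℝ} {t : ℝ}

theorem lipschitzWith_coupledField {B₁ B₂ : ℝ≥0} (h₁ : ∀ x, |Q₁ x| ≤ B₁) (h₂ : ∀ x, |Q₂ x| ≤ B₂)
    (ht : |t| ≤ 1) (x : ℝ) : LipschitzWith (B₁ + B₂ + 1) (coupledField Q₁ Q₂ t x) := by
  refine LipschitzWith.of_dist_le_mul fun z w => ?_
  have hd : ∀ i, |z i - w i| ≤ dist z w := fun i => dist_le_pi_dist z w i
  have hd0 : 0 ≤ dist z w := dist_nonneg
  have hB : dist z w ≤ ((B₁ + B₂ + 1 : ℝ≥0) : ℝ) * dist z w := by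
    push_cast
    nlinarith [B₁.2, B₂.2, mul_nonneg (add_nonneg B₁.coe_nonneg B₂.coe_nonneg) hd0]
  have hmul : ∀ (a b : ℝ) (B : ℝ≥0) (i j : Fin 4), |a| ≤ B → |b| ≤ 1 →
      |a * (z i - w i)| + |b * (z j - w j)| ≤ (B + 1) * dist z w := by
    intro a b B i j ha hb
    rw [abs_mul, abs_mul, add_mul]
    exact add_le_add (mul_le_mul ha (hd i) (abs_nonneg _) B.2)
      (mul_le_mul hb (hd j) (abs_nonneg _) zero_le_one)
  rw [dist_pi_le_iff (by positivity)]
  intro i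
  fin_cases i
  · exact (hd 1).trans hB
  · change |(Q₁ x * z 0 + t * z 2) - (Q₁ x * w 0 + t * w 2)| ≤ _
    calc _ = |Q₁ x * (z 0 - w 0) + t * (z 2 - w 2)| := by ring_nf
      _ ≤ _ := abs_add_le _ _
      _ ≤ (B₁ + 1) * dist z w := hmul _ _ _ _ _ (h₁ x) ht
      _ ≤ _ := by push_cast; gcongr; linarith [B₂.coe_nonneg]
  · exact (hd 3).trans hB
  · change |(Q₂ x * z 2 - t * z 0) - (Q₂ x * w 2 - t * w 0)| ≤ _
    calc _ = |Q₂ x * (z 2 - w 2) - t * (z 0 - w 0)| := by ring_nf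
      _ ≤ _ := abs_sub _ _
      _ ≤ (B₂ + 1) * dist z w := hmul _ _ _ _ _ (h₂ x) ht
      _ ≤ _ := by push_cast; gcongr; linarith [B₁.coe_nonneg]

namespace IsCoupledSol

theorem apply {z : ℝ → Fin 4 → ℝ} (h : IsCoupledSol Q₁ Q₂ t z) (x : ℝ) (i : Fin 4) :
    HasDerivAt (fun x => z x i) (coupledField Q₁ Q₂ t x (z x) i) x :=
  hasDerivAt_pi.1 (h x) i

theorem sum {ι : Type*} [Fintype ι] {z : ι → ℝ → Fin 4 → ℝ}
    (h : ∀ j, IsCoupledSol Q₁ Q₂ t (z j)) (a : ι → ℝ) :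
    IsCoupledSol Q₁ Q₂ t (fun x i => ∑ j, a j * z j x i) := by
  intro x
  rw [hasDerivAt_pi]
  intro i
  refine (HasDerivAt.fun_sum fun j _ => ((h j).apply x i).const_mul (a j)).congr_deriv ?_
  fin_cases i
  · simp [coupledField]
  · simp only [coupledField, Fin.mk_one, Matrix.cons_val_one, Matrix.cons_val_zero, Finset.mul_sum,
      ← Finset.sum_add_distrib]
    exact Finset.sum_congr rfl fun j _ => by ring
  · simp [coupledField]
  · simp only [coupledField, Finset.mul_sum, ← Finset.sum_sub_distrib]
    exact Finset.sum_congr rfl fun j _ => by simp; ring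

theorem shift {z : ℝ → Fin 4 → ℝ} (h : IsCoupledSol Q₁ Q₂ t z) (h₁ : ∀ x, Q₁ (x + 1) = Q₁ x)
    (h₂ : ∀ x, Q₂ (x + 1) = Q₂ x) : IsCoupledSol Q₁ Q₂ t (fun x => z (x + 1)) := by
  intro x
  refine ((h (x + 1)).comp_add_const x 1).congr_deriv ?_
  simp only [coupledField, h₁, h₂]

/-- The symplectic form preserved by the coupled system. -/
theorem form_eq {z w : ℝ → Fin 4 → ℝ} (hz : IsCoupledSol Q₁ Q₂ t z) (hw : IsCoupledSol Q₁ Q₂ t w)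
    (x y : ℝ) :
    z x 0 * w x 1 - z x 1 * w x 0 - (z x 2 * w x 3 - z x 3 * w x 2) =
      z y 0 * w y 1 - z y 1 * w y 0 - (z y 2 * w y 3 - z y 3 * w y 2) := by
  -- Each Wronskian contributes the same coupling term `t (z₀ w₂ - z₂ w₀)`; the relative minus sign
  -- cancels them.
  refine eq_of_hasDerivAt_zero
    (f := fun x => z x 0 * w x 1 - z x 1 * w x 0 - (z x 2 * w x 3 - z x 3 * w x 2)) (fun x => ?_) x y
  refine ((((hz.apply x 0).mul (hw.apply x 1)).sub ((hz.apply x 1).mul (hw.apply x 0))).sub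
    (((hz.apply x 2).mul (hw.apply x 3)).sub ((hz.apply x 3).mul (hw.apply x 2)))).congr_deriv ?_
  simp [coupledField]
  ring

theorem ext_of_initial {B₁ B₂ : ℝ≥0} (h₁ : ∀ x, |Q₁ x| ≤ B₁) (h₂ : ∀ x, |Q₂ x| ≤ B₂)
    (ht : |t| ≤ 1) {z w : ℝ → Fin 4 → ℝ} (hz : IsCoupledSol Q₁ Q₂ t z)
    (hw : IsCoupledSol Q₁ Q₂ t w) (h0 : z 0 = w 0) : z = w :=
  ODE_solution_unique_univ (v := coupledField Q₁ Q₂ t) (s := fun _ => univ) (t₀ := 0)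
    (fun x => (lipschitzWith_coupledField h₁ h₂ ht x).lipschitzOnWith)
    (fun x => ⟨hz x, mem_univ _⟩) (fun x => ⟨hw x, mem_univ _⟩) h0

end IsCoupledSol

theorem exists_isCoupledSol (hc₁ : Continuous Q₁) (hc₂ : Continuous Q₂) {B₁ B₂ : ℝ≥0}
    (h₁ : ∀ x, |Q₁ x| ≤ B₁) (h₂ : ∀ x, |Q₂ x| ≤ B₂) (ht : |t| ≤ 1) (z₀ : Fin 4 → ℝ) :
    ∃ z, IsCoupledSol Q₁ Q₂ t z ∧ z 0 = z₀ := by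
  obtain ⟨z, h0, hz⟩ := exists_global_solution (f := coupledField Q₁ Q₂ t) (K := B₁ + B₂ + 1) (by
      refine continuous_pi fun i => ?_
      fin_cases i <;> simp [coupledField] <;> fun_prop)
    (lipschitzWith_coupledField h₁ h₂ ht) (fun x => by
      funext i; fin_cases i <;> simp [coupledField]) z₀
  exact ⟨z, hz, h0⟩

/-- Continuous dependence of the period map on the coupling. -/
theorem IsCoupledSol.exists_close {B₁ B₂ : ℝ≥0} (h₁ : ∀ x, |Q₁ x| ≤ B₁) (h₂ : ∀ x, |Q₂ x| ≤ B₂)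
    {w : ℝ → Fin 4 → ℝ} (hw : IsCoupledSol Q₁ Q₂ 0 w) {ε : ℝ} (hε : 0 < ε) :
    ∃ η > 0, ∀ {t : ℝ} {z : ℝ → Fin 4 → ℝ}, |t| ≤ η → |t| ≤ 1 → IsCoupledSol Q₁ Q₂ t z →
      z 0 = w 0 → ‖z 1 - w 1‖ < ε := by
  have hwc : Continuous w := continuous_iff_continuousAt.2 fun x => (hw x).continuousAt
  obtain ⟨S, hS⟩ := isCompact_Icc.exists_bound_of_continuousOn (s := Icc (0 : ℝ) 1) hwc.continuousOn
  have hS0 : 0 ≤ S := (norm_nonneg _).trans (hS 0 (by simp))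
  obtain ⟨η, hη, H⟩ := exists_close_of_vectorField_close (K := B₁ + B₂ + 1) hε
  refine ⟨η / (S + 1), by positivity, ?_⟩
  intro t z ht ht1 hz h0
  refine H (f := coupledField Q₁ Q₂ t) (g := coupledField Q₁ Q₂ 0)
    (lipschitzWith_coupledField h₁ h₂ ht1) h0 hz hw fun x hx => ?_
  have hwi : ∀ i, |t| * |w x i| ≤ η := by
    intro i
    calc |t| * |w x i| ≤ (η / (S + 1)) * (S + 1) := by
          gcongr
          exact ((norm_le_pi_norm (w x) i).trans (hS x hx)).trans (by linarith)
      _ = η := by field_simp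
  rw [pi_norm_le_iff_of_nonneg hη.le]
  intro i
  fin_cases i
  · simpa [coupledField] using hη.le
  · simpa [coupledField, abs_mul] using hwi 2
  · simpa [coupledField] using hη.le
  · simpa [coupledField, abs_mul] using hwi 0

end Coupled

/-! ### Characteristic polynomials of symplectic matrices on the unit circle. -/

/-- `det (N - lam)` for a real matrix `N` and complex `lam`. -/
noncomputable def charDet (N : Matrix (Fin 4) (Fin 4) ℝ) (lam : ℂ) : ℂ :=
  (N.map (Complex.ofRealHom) - lam • (1 : Matrix (Fin 4) (Fin 4) ℂ)).det

theorem continuous_charDet : Continuous fun p : Matrix (Fin 4) (Fin 4) ℝ × ℂ => charDet p.1 p.2 := by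
  unfold charDet
  refine Continuous.matrix_det ?_
  refine Continuous.sub (continuous_fst.matrix_map Complex.continuous_ofReal) ?_
  exact continuous_snd.smul continuous_const

theorem conj_charDet (N : Matrix (Fin 4) (Fin 4) ℝ) (lam : ℂ) :
    (starRingEnd ℂ) (charDet N lam) = charDet N ((starRingEnd ℂ) lam) := by
  unfold charDet
  rw [RingHom.map_det]
  congr 1
  ext i j
  by_cases h : i = j <;> simp [h]

/-- The matrix of the symplectic form of the coupled system. -/
noncomputable def formMatrix : Matrix (Fin 4) (Fin 4) ℝ :=
  !![0, 1, 0, 0; -1, 0, 0, 0; 0, 0, 0, -1; 0, 0, 1, 0]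

theorem det_formMatrix : formMatrix.det = 1 := by
  simp [formMatrix, Matrix.det_succ_row_zero, Fin.sum_univ_succ, Fin.succAbove]

/-- The characteristic polynomial of a symplectic matrix is palindromic. -/
theorem charDet_inv {N : Matrix (Fin 4) (Fin 4) ℝ} (hN : N * formMatrix * Nᵀ = formMatrix)
    (hdet : 0 < N.det) {lam : ℂ} (hlam : lam ≠ 0) : charDet N lam = lam ^ 4 * charDet N lam⁻¹ := by
  -- Determinants in the symplectic relation give only `det² = 1`; positivity selects the sign.
  have hdet1 : N.det = 1 := by
    have := congrArg Matrix.det hN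
    rw [Matrix.det_mul, Matrix.det_mul, det_formMatrix, Matrix.det_transpose] at this
    nlinarith
  set C : Matrix (Fin 4) (Fin 4) ℂ := N.map Complex.ofRealHom with hC
  set J : Matrix (Fin 4) (Fin 4) ℂ := formMatrix.map Complex.ofRealHom with hJ
  have hCJ : C * J * Cᵀ = J := by
    rw [hC, hJ, ← Matrix.transpose_map, ← Matrix.map_mul, ← Matrix.map_mul, hN]
  have hJd : J.det = 1 := by
    rw [hJ, ← RingHom.mapMatrix_apply, ← RingHom.map_det, det_formMatrix, map_one]
  have hCd : C.det = 1 := by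
    rw [hC, ← RingHom.mapMatrix_apply, ← RingHom.map_det, hdet1, map_one]
  -- Because `C J Cᵀ = J`, the left side is `J (1 - λ Cᵀ)`, which brings in `C - λ⁻¹`.
  have h1 : (C - lam • 1) * J * Cᵀ = J * (-lam • (C - lam⁻¹ • 1))ᵀ := by
    have e1 : (-lam • (C - lam⁻¹ • 1))ᵀ = 1 - lam • Cᵀ := by
      rw [smul_sub, smul_smul, neg_mul, mul_inv_cancel₀ hlam]
      ext i j
      simp [Matrix.one_apply, eq_comm]
      ring
    rw [e1, sub_mul, sub_mul, hCJ, mul_sub, mul_one]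
    simp
  have h2 := congrArg Matrix.det h1
  rw [Matrix.det_mul, Matrix.det_mul, Matrix.det_mul, Matrix.det_transpose, Matrix.det_transpose,
    hJd, hCd, mul_one, mul_one, one_mul, Matrix.det_smul, Fintype.card_fin] at h2
  change charDet N lam = (-lam) ^ 4 * charDet N lam⁻¹ at h2
  rw [h2]; ring

/-- On the circle `λ⁻¹` is the conjugate of `λ`, so the palindromic symmetry and the real entries
make `λ⁻² det (N - λ)` self-conjugate. Being real, it is open to the intermediate value theorem. -/
theorem charDet_im_eq_zero {N : Matrix (Fin 4) (Fin 4) ℝ}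
    (hN : N * formMatrix * Nᵀ = formMatrix) (hdet : 0 < N.det) {lam : ℂ} (hlam : ‖lam‖ = 1) :
    ((starRingEnd ℂ) lam ^ 2 * charDet N lam).im = 0 := by
  have h0 : lam ≠ 0 := by rintro rfl; simp at hlam
  have hinv : (starRingEnd ℂ) lam = lam⁻¹ := by
    rw [Complex.inv_def, Complex.normSq_eq_norm_sq, hlam]; simp
  rw [← Complex.conj_eq_iff_im, map_mul, map_pow, conj_charDet, Complex.conj_conj, hinv,
    charDet_inv hN hdet h0]
  field_simp

/-- The real function on the unit circle whose zeros are the unimodular eigenvalues. -/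
noncomputable def circleDet (N : Matrix (Fin 4) (Fin 4) ℝ) (x : ℝ) : ℝ :=
  ((starRingEnd ℂ) (Complex.exp (x * Complex.I)) ^ 2 * charDet N (Complex.exp (x * Complex.I))).re

theorem continuous_circleDet :
    Continuous fun p : Matrix (Fin 4) (Fin 4) ℝ × ℝ => circleDet p.1 p.2 := by
  unfold circleDet
  have h1 : Continuous fun p : Matrix (Fin 4) (Fin 4) ℝ × ℝ => Complex.exp (p.2 * Complex.I) := by
    fun_prop
  have h2 := continuous_charDet.comp (continuous_fst.prodMk h1)
  exact Complex.continuous_re.comp (((Complex.continuous_conj.comp h1).pow 2).mul h2)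

theorem exists_unimodular_eigenvalue {N : Matrix (Fin 4) (Fin 4) ℝ}
    (hN : N * formMatrix * Nᵀ = formMatrix) (hdet : 0 < N.det) {a b : ℝ}
    (hab : circleDet N a * circleDet N b < 0) :
    ∃ lam : ℂ, ‖lam‖ = 1 ∧ charDet N lam = 0 := by
  have hc : Continuous fun x => circleDet N x := by
    have := continuous_circleDet.comp (Continuous.prodMk_right N)
    simpa only [Function.comp_def] using this
  have : (0 : ℝ) ∈ uIcc (circleDet N a) (circleDet N b) := by
    rcases mul_neg_iff.1 hab with h | h
    · exact mem_uIcc.2 (Or.inr ⟨h.2.le, h.1.le⟩)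
    · exact mem_uIcc.2 (Or.inl ⟨h.1.le, h.2.le⟩)
  obtain ⟨x, -, hx⟩ := intermediate_value_uIcc hc.continuousOn this
  simp only [circleDet] at hx
  set lam := Complex.exp (x * Complex.I) with hlam
  have h1 : ‖lam‖ = 1 := Complex.norm_exp_ofReal_mul_I x
  refine ⟨lam, h1, ?_⟩
  have h2 : (starRingEnd ℂ) lam ^ 2 * charDet N lam = 0 :=
    Complex.ext (by rw [hx, Complex.zero_re]) (by rw [charDet_im_eq_zero hN hdet h1, Complex.zero_im])
  have h3 : (starRingEnd ℂ) lam ^ 2 ≠ 0 := by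
    apply pow_ne_zero
    rw [map_ne_zero]
    exact Complex.exp_ne_zero _
  exact (mul_eq_zero.1 h2).resolve_left h3

/-- The period map (transposed) of the uncoupled system. -/
noncomputable def uncoupledMatrix (c₁ c₁' s₁ s₁' c₂ c₂' s₂ s₂' : ℝ) : Matrix (Fin 4) (Fin 4) ℝ :=
  !![c₁, c₁', 0, 0; s₁, s₁', 0, 0; 0, 0, c₂, c₂'; 0, 0, s₂, s₂']

theorem det_uncoupledMatrix {c₁ c₁' s₁ s₁' c₂ c₂' s₂ s₂' : ℝ} (h₁ : c₁ * s₁' - s₁ * c₁' = 1)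
    (h₂ : c₂ * s₂' - s₂ * c₂' = 1) : (uncoupledMatrix c₁ c₁' s₁ s₁' c₂ c₂' s₂ s₂').det = 1 := by
  have : (uncoupledMatrix c₁ c₁' s₁ s₁' c₂ c₂' s₂ s₂').det =
      (c₁ * s₁' - s₁ * c₁') * (c₂ * s₂' - s₂ * c₂') := by
    simp [uncoupledMatrix, Matrix.det_succ_row_zero, Fin.sum_univ_succ, Fin.succAbove]
    ring
  rw [this, h₁, h₂, one_mul]

theorem circleDet_uncoupledMatrix {c₁ c₁' s₁ s₁' c₂ c₂' s₂ s₂' : ℝ} (h₁ : c₁ * s₁' - s₁ * c₁' = 1)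
    (h₂ : c₂ * s₂' - s₂ * c₂' = 1) (x : ℝ) :
    circleDet (uncoupledMatrix c₁ c₁' s₁ s₁' c₂ c₂' s₂ s₂') x =
      (2 * Real.cos x - (c₁ + s₁')) * (2 * Real.cos x - (c₂ + s₂')) := by
  set lam := Complex.exp (x * Complex.I) with hlam
  have e1 : charDet (uncoupledMatrix c₁ c₁' s₁ s₁' c₂ c₂' s₂ s₂') lam =
      (lam ^ 2 - (c₁ + s₁') * lam + 1) * (lam ^ 2 - (c₂ + s₂') * lam + 1) := by
    have : charDet (uncoupledMatrix c₁ c₁' s₁ s₁' c₂ c₂' s₂ s₂') lam =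
        ((c₁ - lam) * (s₁' - lam) - s₁ * c₁') * ((c₂ - lam) * (s₂' - lam) - s₂ * c₂') := by
      simp [charDet, uncoupledMatrix, Matrix.det_succ_row_zero, Fin.sum_univ_succ, Fin.succAbove,
        Matrix.one_apply]
      ring
    rw [this]
    have h₁' : (c₁ : ℂ) * s₁' - s₁ * c₁' = 1 := by exact_mod_cast h₁
    have h₂' : (c₂ : ℂ) * s₂' - s₂ * c₂' = 1 := by exact_mod_cast h₂
    have a1 : ((c₁ : ℂ) - lam) * (s₁' - lam) - s₁ * c₁' = lam ^ 2 - (c₁ + s₁') * lam + 1 := by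
      linear_combination h₁'
    have a2 : ((c₂ : ℂ) - lam) * (s₂' - lam) - s₂ * c₂' = lam ^ 2 - (c₂ + s₂') * lam + 1 := by
      linear_combination h₂'
    rw [a1, a2]
  have hconj : (starRingEnd ℂ) lam = Complex.exp (-(x * Complex.I)) := by
    rw [hlam, ← Complex.exp_conj]; simp
  have hm : (starRingEnd ℂ) lam * lam = 1 := by
    rw [hconj, hlam, ← Complex.exp_add]; simp
  have hs : lam + (starRingEnd ℂ) lam = ((2 * Real.cos x : ℝ) : ℂ) := by
    rw [hconj, hlam]; push_cast; rw [Complex.two_cos]; simp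
  unfold circleDet
  rw [← hlam, e1]
  have : (starRingEnd ℂ) lam ^ 2 * ((lam ^ 2 - (c₁ + s₁') * lam + 1) *
      (lam ^ 2 - (c₂ + s₂') * lam + 1)) =
      (((2 * Real.cos x - (c₁ + s₁')) * (2 * Real.cos x - (c₂ + s₂')) : ℝ) : ℂ) := by
    have a : ∀ T : ℂ, (starRingEnd ℂ) lam * (lam ^ 2 - T * lam + 1) =
        ((2 * Real.cos x : ℝ) : ℂ) - T := by
      intro T; rw [← hs]; linear_combination (lam - T) * hm
    calc _ = ((starRingEnd ℂ) lam * (lam ^ 2 - (c₁ + s₁') * lam + 1)) *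
        ((starRingEnd ℂ) lam * (lam ^ 2 - (c₂ + s₂') * lam + 1)) := by ring
      _ = _ := by rw [a, a]; push_cast; ring
  rw [this, Complex.ofReal_re]

/-- On `|cos| < 1` the factor `2 cos - T₁` keeps one strict sign, while `2 cos - T₂` changes sign at
`T₂ / 2`. The witnesses are the midpoints between `T₂ / 2` and `±1`. -/
theorem exists_sign_change {T₁ T₂ : ℝ} (h₁ : |T₁| = 2) (h₂ : |T₂| < 2) :
    ∃ a b : ℝ, ((2 * Real.cos a - T₁) * (2 * Real.cos a - T₂)) *
      ((2 * Real.cos b - T₁) * (2 * Real.cos b - T₂)) < 0 := by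
  obtain ⟨h3, h4⟩ := abs_lt.1 h₂
  set u := (T₂ / 2 + 1) / 2 with hu
  set w := (T₂ / 2 - 1) / 2 with hw
  refine ⟨Real.arccos u, Real.arccos w, ?_⟩
  rw [Real.cos_arccos (by linarith) (by linarith), Real.cos_arccos (by linarith) (by linarith)]
  have e1 : 0 < 2 * u - T₂ := by linarith
  have e2 : 2 * w - T₂ < 0 := by linarith
  have e3 : 0 < (2 * u - T₁) * (2 * w - T₁) := by
    rcases (abs_eq (by norm_num : (0 : ℝ) ≤ 2)).1 h₁ with h | h
    · exact mul_pos_of_neg_of_neg (by linarith) (by linarith)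
    · exact mul_pos (by linarith) (by linarith)
  have := mul_neg_of_pos_of_neg e3 (mul_neg_of_pos_of_neg e1 e2)
  linarith

/-! ### Bounded solutions of the coupled system. -/

/-- A bounded nontrivial complex solution of `v'' = Q₁ v + t p`, `p'' = Q₂ p - t v`. -/
structure IsBoundedCoupledSol (Q₁ Q₂ : ℝ → ℝ) (t : ℝ) (v v' p p' : ℝ → ℂ) : Prop where
  deriv_v : ∀ x, HasDerivAt v (v' x) x
  deriv_v' : ∀ x, HasDerivAt v' (Q₁ x * v x + t * p x) x
  deriv_p : ∀ x, HasDerivAt p (p' x) x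
  deriv_p' : ∀ x, HasDerivAt p' (Q₂ x * p x - t * v x) x
  bounded : ∃ C : ℝ, ∀ x, ‖v x‖ ≤ C ∧ ‖v' x‖ ≤ C ∧ ‖p x‖ ≤ C ∧ ‖p' x‖ ≤ C
  nontrivial : ∃ x, v x ≠ 0 ∨ p x ≠ 0

/-- An open condition on a matrix holds for all entrywise close matrices. -/
theorem exists_close_of_isOpen {n : Type*} [Fintype n] {S : Set (Matrix n n ℝ)} (hS : IsOpen S)
    {N : Matrix n n ℝ} (hN : N ∈ S) :
    ∃ ε > 0, ∀ N' : Matrix n n ℝ, (∀ i, ‖N' i - N i‖ < ε) → N' ∈ S := by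
  obtain ⟨ε, hε, h⟩ := Metric.isOpen_iff.1 (show IsOpen (X := n → n → ℝ) S from hS) N hN
  exact ⟨ε, hε, fun N' hN' => h (show dist (α := n → n → ℝ) N' N < ε from
    (dist_pi_lt_iff hε).2 fun i => by rw [dist_eq_norm]; exact hN' i)⟩

/-- The rows of the matrix are the solutions at time one, so a left eigenvector is the initial
vector of a Floquet solution. Its multiplier is unimodular, hence its modulus is periodic and
bounded. -/
theorem exists_isBoundedCoupledSol_of_eigenvalue {Q₁ Q₂ : ℝ → ℝ} {t : ℝ}
    {B₁ B₂ : ℝ≥0} (h₁ : ∀ x, |Q₁ x| ≤ B₁) (h₂ : ∀ x, |Q₂ x| ≤ B₂) (ht : |t| ≤ 1)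
    (hp₁ : ∀ x, Q₁ (x + 1) = Q₁ x) (hp₂ : ∀ x, Q₂ (x + 1) = Q₂ x)
    {z : Fin 4 → ℝ → Fin 4 → ℝ} (hz : ∀ j, IsCoupledSol Q₁ Q₂ t (z j))
    (h0 : ∀ j, z j 0 = Pi.single j 1) {lam : ℂ} (hlam : ‖lam‖ = 1)
    (hdet : charDet (Matrix.of fun j => z j 1) lam = 0) :
    ∃ v v' p p', IsBoundedCoupledSol Q₁ Q₂ t v v' p p' := by
  obtain ⟨a, ha, hav⟩ := Matrix.exists_vecMul_eq_zero_iff.2 hdet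
  have heig : ∀ i, ∑ j, a j * (z j 1 i : ℂ) = lam * a i := by
    intro i
    have := congrFun hav i
    rw [Matrix.vecMul_sub, Matrix.vecMul_smul, Matrix.vecMul_one] at this
    simp only [Pi.sub_apply, Pi.smul_apply, smul_eq_mul, Pi.zero_apply, sub_eq_zero] at this
    rw [← this]
    simp [Matrix.vecMul, dotProduct]
  have hshift : ∀ j x i, z j (x + 1) i = ∑ k, z j 1 k * z k x i := by
    intro j x i
    have := ((hz j).shift hp₁ hp₂).ext_of_initial h₁ h₂ ht (IsCoupledSol.sum hz (z j 1)) (by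
      funext i
      simp [h0, Pi.single_apply])
    exact congrFun (congrFun this x) i
  set Z : Fin 4 → ℝ → ℂ := fun i x => ∑ j, a j * (z j x i : ℂ) with hZ
  have hZs : ∀ i x, Z i (x + 1) = lam * Z i x := by
    intro i x
    simp only [hZ, hshift, Complex.ofReal_sum, Complex.ofReal_mul, Finset.mul_sum]
    rw [Finset.sum_comm]
    refine Finset.sum_congr rfl fun k _ => ?_
    rw [← mul_assoc, ← heig k, Finset.sum_mul]
    exact Finset.sum_congr rfl fun j _ => by ring
  have hZd : ∀ i x, HasDerivAt (Z i) (∑ j, a j * (coupledField Q₁ Q₂ t x (z j x) i : ℂ)) x :=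
    fun i x => HasDerivAt.fun_sum fun j _ => (((hz j).apply x i).ofReal_comp).const_mul (a j)
  have hZc : ∀ i, Continuous (Z i) := fun i =>
    continuous_iff_continuousAt.2 fun x => (hZd i x).continuousAt
  have hbd : ∀ i, ∃ C : ℝ, ∀ x, ‖Z i x‖ ≤ C := by
    intro i
    obtain ⟨C, -, hC⟩ := exists_abs_le_of_periodic (Q := fun x => ‖Z i x‖) (hZc i).norm
      (fun x => by rw [hZs, norm_mul, hlam, one_mul])
    exact ⟨C, fun x => by simpa using hC x⟩
  choose C hC using hbd
  refine ⟨Z 0, Z 1, Z 2, Z 3, fun x => ?_, fun x => ?_, fun x => ?_, fun x => ?_, ?_, ?_⟩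
  · exact (hZd 0 x).congr_deriv (by simp [coupledField, hZ])
  · refine (hZd 1 x).congr_deriv ?_
    simp only [coupledField, hZ, Finset.mul_sum, ← Finset.sum_add_distrib]
    exact Finset.sum_congr rfl fun j _ => by simp; ring
  · exact (hZd 2 x).congr_deriv (by simp [coupledField, hZ])
  · refine (hZd 3 x).congr_deriv ?_
    simp only [coupledField, hZ, Finset.mul_sum, ← Finset.sum_sub_distrib]
    exact Finset.sum_congr rfl fun j _ => by simp; ring
  · have hle : ∀ i, C i ≤ ∑ j, C j := fun i =>
      Finset.single_le_sum (fun j _ => (norm_nonneg _).trans (hC j 0)) (Finset.mem_univ i)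
    exact ⟨∑ j, C j, fun x => ⟨(hC 0 x).trans (hle 0), (hC 1 x).trans (hle 1),
      (hC 2 x).trans (hle 2), (hC 3 x).trans (hle 3)⟩⟩
  -- If `v` and `p` vanish identically, so do their derivatives, and the eigenvector `a` would be
  -- zero.
  · by_contra! hcon
    have hZ0 : ∀ i, Z i 0 = a i := fun i => by
      simp only [hZ, h0]
      rw [Finset.sum_eq_single i (fun j _ hj => by simp [hj.symm]) (by simp)]
      simp
    have hv : Z 0 = fun _ => 0 := funext fun x => (hcon x).1
    have hp : Z 2 = fun _ => 0 := funext fun x => (hcon x).2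
    have hv' : Z 1 0 = 0 := by
      have h1 : HasDerivAt (Z 0) (Z 1 0) 0 := (hZd 0 0).congr_deriv (by simp [coupledField, hZ])
      rw [hv] at h1
      exact h1.unique (hasDerivAt_const _ _)
    have hp' : Z 3 0 = 0 := by
      have h1 : HasDerivAt (Z 2) (Z 3 0) 0 := (hZd 2 0).congr_deriv (by simp [coupledField, hZ])
      rw [hp] at h1
      exact h1.unique (hasDerivAt_const _ _)
    apply ha
    funext i
    rw [← hZ0 i]
    fin_cases i
    · exact congrFun hv 0
    · exact hv'
    · exact congrFun hp 0
    · exact hp'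

theorem IsSol.isCoupledSol_left {Q₁ Q₂ y y' : ℝ → ℝ} (h : IsSol Q₁ y y') :
    IsCoupledSol Q₁ Q₂ 0 fun x => ![y x, y' x, 0, 0] := by
  intro x
  rw [hasDerivAt_pi]
  intro i
  fin_cases i
  · simpa [coupledField] using h.deriv₁ x
  · simpa [coupledField] using h.deriv₂ x
  · simpa [coupledField] using hasDerivAt_const x (0 : ℝ)
  · simpa [coupledField] using hasDerivAt_const x (0 : ℝ)

theorem IsSol.isCoupledSol_right {Q₁ Q₂ y y' : ℝ → ℝ} (h : IsSol Q₂ y y') :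
    IsCoupledSol Q₁ Q₂ 0 fun x => ![0, 0, y x, y' x] := by
  intro x
  rw [hasDerivAt_pi]
  intro i
  fin_cases i
  · simpa [coupledField] using hasDerivAt_const x (0 : ℝ)
  · simpa [coupledField] using hasDerivAt_const x (0 : ℝ)
  · simpa [coupledField] using h.deriv₁ x
  · simpa [coupledField] using h.deriv₂ x

/-- If the uncoupled period maps are parabolic and elliptic, then for small coupling the coupled
system has a bounded solution. -/
theorem exists_isBoundedCoupledSol {Q₁ Q₂ : ℝ → ℝ} (hc₁ : Continuous Q₁) (hc₂ : Continuous Q₂)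
    (hp₁ : ∀ x, Q₁ (x + 1) = Q₁ x) (hp₂ : ∀ x, Q₂ (x + 1) = Q₂ x)
    {c₁ c₁' s₁ s₁' c₂ c₂' s₂ s₂' : ℝ → ℝ} (hf₁ : IsFund Q₁ c₁ c₁' s₁ s₁')
    (hf₂ : IsFund Q₂ c₂ c₂' s₂ s₂') (hT₁ : |c₁ 1 + s₁' 1| = 2) (hT₂ : |c₂ 1 + s₂' 1| < 2) :
    ∃ τ₀ > 0, ∀ t : ℝ, |t| < τ₀ → ∃ v v' p p', IsBoundedCoupledSol Q₁ Q₂ t v v' p p' := by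
  obtain ⟨B₁, -, h₁⟩ := exists_abs_le_of_periodic hc₁ hp₁
  obtain ⟨B₂, -, h₂⟩ := exists_abs_le_of_periodic hc₂ hp₂
  obtain ⟨a, b, hab⟩ := exists_sign_change hT₁ hT₂
  set N₀ := uncoupledMatrix (c₁ 1) (c₁' 1) (s₁ 1) (s₁' 1) (c₂ 1) (c₂' 1) (s₂ 1) (s₂' 1) with hN₀
  rw [← circleDet_uncoupledMatrix (hf₁.wronskian 1) (hf₂.wronskian 1),
    ← circleDet_uncoupledMatrix (hf₁.wronskian 1) (hf₂.wronskian 1), ← hN₀] at hab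
  have hcirc : ∀ x, Continuous fun N : Matrix (Fin 4) (Fin 4) ℝ => circleDet N x := by
    intro x
    have := continuous_circleDet.comp (Continuous.prodMk_left x)
    simpa only [Function.comp_def] using this
  -- Both conditions are open and hold for the uncoupled period map, hence for all small couplings.
  have hopen : IsOpen {N : Matrix (Fin 4) (Fin 4) ℝ |
      circleDet N a * circleDet N b < 0 ∧ 0 < N.det} :=
    (isOpen_lt ((hcirc a).mul (hcirc b)) continuous_const).inter
      (isOpen_lt continuous_const continuous_id.matrix_det)
  obtain ⟨ε, hε, hclose⟩ := exists_close_of_isOpen hopen (N := N₀)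
    ⟨hab, by rw [hN₀, det_uncoupledMatrix (hf₁.wronskian 1) (hf₂.wronskian 1)]; exact one_pos⟩
  set w : Fin 4 → ℝ → Fin 4 → ℝ := ![fun x => ![c₁ x, c₁' x, 0, 0], fun x => ![s₁ x, s₁' x, 0, 0],
    fun x => ![0, 0, c₂ x, c₂' x], fun x => ![0, 0, s₂ x, s₂' x]] with hw
  have hwsol : ∀ j, IsCoupledSol Q₁ Q₂ 0 (w j) := by
    intro j
    fin_cases j
    · exact hf₁.solC.isCoupledSol_left
    · exact hf₁.solS.isCoupledSol_left
    · exact hf₂.solC.isCoupledSol_right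
    · exact hf₂.solS.isCoupledSol_right
  have hw0 : ∀ j, w j 0 = Pi.single j 1 := by
    intro j
    funext i
    fin_cases j <;> fin_cases i <;>
      simp [hw, hf₁.c_zero, hf₁.c'_zero, hf₁.s_zero, hf₁.s'_zero, hf₂.c_zero, hf₂.c'_zero,
        hf₂.s_zero, hf₂.s'_zero]
  have hw1 : ∀ j, w j 1 = N₀ j := by
    intro j
    fin_cases j <;> rfl
  choose η hη H using fun j => (hwsol j).exists_close h₁ h₂ hε
  obtain ⟨η₀, hη₀, hmin⟩ : ∃ η₀ > 0, ∀ j, η₀ ≤ η j :=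
    ⟨Finset.univ.inf' Finset.univ_nonempty η, by
      rw [gt_iff_lt, Finset.lt_inf'_iff]; exact fun j _ => hη j,
      fun j => Finset.inf'_le _ (Finset.mem_univ j)⟩
  refine ⟨min 1 η₀, by positivity, fun t ht => ?_⟩
  have ht1 : |t| ≤ 1 := ht.le.trans (min_le_left _ _)
  have htη : |t| ≤ η₀ := ht.le.trans (min_le_right _ _)
  choose z hz hz0 using fun j : Fin 4 =>
    exists_isCoupledSol hc₁ hc₂ h₁ h₂ ht1 (Pi.single j 1 : Fin 4 → ℝ)
  set N : Matrix (Fin 4) (Fin 4) ℝ := Matrix.of fun j => z j 1 with hN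
  obtain ⟨hNab, hNdet⟩ := hclose N fun j => by
    rw [← hw1]
    exact H j (htη.trans (hmin j)) ht1 (hz j) ((hz0 j).trans (hw0 j).symm)
  have hsymp : N * formMatrix * Nᵀ = formMatrix := by
    ext i j
    have h := (hz i).form_eq (hz j) 1 0
    rw [hz0, hz0] at h
    have e1 : (N * formMatrix * Nᵀ) i j =
        z i 1 0 * z j 1 1 - z i 1 1 * z j 1 0 - (z i 1 2 * z j 1 3 - z i 1 3 * z j 1 2) := by
      simp [Matrix.mul_apply, Fin.sum_univ_four, formMatrix, hN]
      ring
    rw [e1, h]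
    fin_cases i <;> fin_cases j <;> simp [formMatrix]
  obtain ⟨lam, hlam, hdet⟩ := exists_unimodular_eigenvalue hsymp hNdet hNab
  exact exists_isBoundedCoupledSol_of_eigenvalue h₁ h₂ ht1 hp₁ hp₂ hz hz0 hlam hdet

/-! ### Weak derivatives and cutoffs of bounded solutions. -/

/-- A compactly supported `C²` function has its classical second derivative as weak one. -/
theorem isWeakSecondDeriv_of_hasDerivAt {f f' f'' : ℝ → ℂ} (h₁ : ∀ x, HasDerivAt f (f' x) x)
    (h₂ : ∀ x, HasDerivAt f' (f'' x) x) (hc : Continuous f'') (hs : HasCompactSupport f)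
    {F W : L2} (hF : F =ᵐ[volume] f) (hW : W =ᵐ[volume] f'') : IsWeakSecondDeriv F W := by
  intro χ hχ hχs
  have hf : Continuous f := continuous_iff_continuousAt.2 fun x => (h₁ x).continuousAt
  have hf' : Continuous f' := continuous_iff_continuousAt.2 fun x => (h₂ x).continuousAt
  have hs' : HasCompactSupport f' := by
    have := hs.deriv
    rwa [show deriv f = f' from funext fun x => (h₁ x).deriv] at this
  have hχ2 : ContDiff ℝ 2 χ := by exact_mod_cast contDiff_infty.1 hχ 2
  have hχd : ContDiff ℝ 1 (deriv χ) := ((contDiff_succ_iff_deriv (n := 1)).1 hχ2).2.2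
  have hχ1 : ∀ x, HasDerivAt χ (deriv χ x) x := fun x =>
    (hχ2.differentiable (by norm_num) x).hasDerivAt
  have hχ1' : ∀ x, HasDerivAt (deriv χ) (iteratedDeriv 2 χ x) x := fun x => by
    rw [iteratedDeriv_succ, iteratedDeriv_one]
    exact (hχd.differentiable (by norm_num) x).hasDerivAt
  have hχc2 : Continuous (iteratedDeriv 2 χ) := by
    rw [iteratedDeriv_succ, iteratedDeriv_one]
    exact hχd.continuous_deriv le_rfl
  have e1 : ∫ x, iteratedDeriv 2 χ x * F x = ∫ x, f x * iteratedDeriv 2 χ x :=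
    integral_congr_ae (hF.mono fun x hx => by simp only [hx, mul_comm])
  have e2 : ∫ x, χ x * W x = ∫ x, f'' x * χ x :=
    integral_congr_ae (hW.mono fun x hx => by simp only [hx, mul_comm])
  have i1 := integral_mul_deriv_eq_deriv_mul_of_integrable (u := f) (u' := f') (v := deriv χ)
    (v' := iteratedDeriv 2 χ) (fun x _ => h₁ x) (fun x _ => hχ1' x)
    ((hf.mul hχc2).integrable_of_hasCompactSupport hs.mul_right)
    ((hf'.mul hχd.continuous).integrable_of_hasCompactSupport hs'.mul_right)
    ((hf.mul hχd.continuous).integrable_of_hasCompactSupport hs.mul_right)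
  have i2 := integral_mul_deriv_eq_deriv_mul_of_integrable (u := f') (u' := f'') (v := χ)
    (v' := deriv χ) (fun x _ => h₂ x) (fun x _ => hχ1 x)
    ((hf'.mul hχd.continuous).integrable_of_hasCompactSupport hs'.mul_right)
    ((hc.mul hχ2.continuous).integrable_of_hasCompactSupport hχs.mul_left)
    ((hf'.mul hχ2.continuous).integrable_of_hasCompactSupport hs'.mul_right)
  rw [e1, e2, i1, i2, neg_neg]

/-- A `C²` cutoff function, with its first two derivatives. -/
structure IsCutoff (χ χ₁ χ₂ : ℝ → ℝ) (C : ℝ) : Prop where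
  deriv₁ : ∀ x, HasDerivAt χ (χ₁ x) x
  deriv₂ : ∀ x, HasDerivAt χ₁ (χ₂ x) x
  continuous₂ : Continuous χ₂
  bound₁ : ∀ x, |χ₁ x| ≤ C
  bound₂ : ∀ x, |χ₂ x| ≤ C
  eq_zero : ∀ x, 2 < |x| → χ x = 0 ∧ χ₁ x = 0 ∧ χ₂ x = 0
  eq_one : ∀ x, |x| ≤ 1 → χ x = 1

theorem exists_isCutoff : ∃ χ χ₁ χ₂ C, IsCutoff χ χ₁ χ₂ C := by
  let b : ContDiffBump (0 : ℝ) := ⟨1, 2, one_pos, one_lt_two⟩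
  have hb : ContDiff ℝ 2 b := b.contDiff
  have hd : ContDiff ℝ 1 (deriv b) := ((contDiff_succ_iff_deriv (n := 1)).1 hb).2.2
  have hcd : Continuous (deriv (deriv b)) := hd.continuous_deriv le_rfl
  obtain ⟨C₁, h₁⟩ := b.hasCompactSupport.deriv.exists_bound_of_continuous hd.continuous
  obtain ⟨C₂, h₂⟩ := b.hasCompactSupport.deriv.deriv.exists_bound_of_continuous hcd
  have hnot : ∀ x : ℝ, 2 < |x| → x ∉ tsupport b := by
    intro x hx hmem
    rw [b.tsupport_eq, Metric.mem_closedBall, dist_zero_right, Real.norm_eq_abs] at hmem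
    exact absurd hmem (not_le.2 hx)
  refine ⟨b, deriv b, deriv (deriv b), max C₁ C₂,
    fun x => (hb.differentiable (by norm_num) x).hasDerivAt,
    fun x => (hd.differentiable (by norm_num) x).hasDerivAt, hcd,
    fun x => (h₁ x).trans (le_max_left _ _), fun x => (h₂ x).trans (le_max_right _ _),
    fun x hx => ⟨?_, ?_, ?_⟩, fun x hx => ?_⟩
  · exact image_eq_zero_of_notMem_tsupport (hnot x hx)
  · exact image_eq_zero_of_notMem_tsupport fun h => hnot x hx (tsupport_deriv_subset h)
  · exact image_eq_zero_of_notMem_tsupport fun h =>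
      hnot x hx (tsupport_deriv_subset (tsupport_deriv_subset h))
  · exact b.one_of_mem_closedBall (by simpa using hx)

section Weyl

variable {χ χ₁ χ₂ : ℝ → ℝ} {C M : ℝ} {w w' h : ℝ → ℂ}

theorem IsCutoff.hasCompactSupport_of_eq_zero {f : ℝ → ℂ} {m : ℝ}
    (hf : ∀ x, 2 * m ^ 2 < |x| → f x = 0) : HasCompactSupport f := by
  refine HasCompactSupport.intro (isCompact_Icc (a := -(2 * m ^ 2)) (b := 2 * m ^ 2)) fun x hx => hf x ?_
  rw [mem_Icc, ← abs_le] at hx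
  exact not_le.1 hx

theorem IsCutoff.lt_abs_div {m x : ℝ} (hm : 1 ≤ m) (hx : 2 * m ^ 2 < |x|) : 2 < |x / m ^ 2| := by
  have : 0 < m ^ 2 := by positivity
  rwa [abs_div, abs_of_pos this, lt_div_iff₀ this]

/-- The cut off function `χ (x / m²) w x`. -/
noncomputable def cutFun (χ : ℝ → ℝ) (m : ℝ) (w : ℝ → ℂ) (x : ℝ) : ℂ := (χ (x / m ^ 2) : ℂ) * w x

/-- The commutator `-½ (χ w)'' + ½ χ w''`. -/
noncomputable def cutErr (χ₁ χ₂ : ℝ → ℝ) (m : ℝ) (w w' : ℝ → ℂ) (x : ℝ) : ℂ :=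
  -(1 / 2) * ((χ₂ (x / m ^ 2) / m ^ 2 / m ^ 2 : ℝ) * w x + 2 * (χ₁ (x / m ^ 2) / m ^ 2 : ℝ) * w' x)

theorem IsCutoff.memLp_cutFun (hχ : IsCutoff χ χ₁ χ₂ C) {m : ℝ} (hm : 1 ≤ m) (hw : Continuous w) :
    MemLp (cutFun χ m w) 2 volume := by
  have hc : Continuous χ := continuous_iff_continuousAt.2 fun x => (hχ.deriv₁ x).continuousAt
  refine Continuous.memLp_of_hasCompactSupport (by unfold cutFun; fun_prop)
    (hasCompactSupport_of_eq_zero (m := m) fun x hx => ?_)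
  simp [cutFun, (hχ.eq_zero _ (lt_abs_div hm hx)).1]

theorem IsCutoff.memLp_cutErr (hχ : IsCutoff χ χ₁ χ₂ C) {m : ℝ} (hm : 1 ≤ m) (hw : Continuous w)
    (hw' : Continuous w') : MemLp (cutErr χ₁ χ₂ m w w') 2 volume := by
  have hc : Continuous χ₁ := continuous_iff_continuousAt.2 fun x => (hχ.deriv₂ x).continuousAt
  have hc2 := hχ.continuous₂
  refine Continuous.memLp_of_hasCompactSupport (by unfold cutErr; fun_prop)
    (hasCompactSupport_of_eq_zero (m := m) fun x hx => ?_)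
  simp [cutErr, (hχ.eq_zero _ (lt_abs_div hm hx)).2]

theorem IsCutoff.norm_cutErr_le (hχ : IsCutoff χ χ₁ χ₂ C) {m : ℝ} (hm : 1 ≤ m)
    (hw : ∀ x, ‖w x‖ ≤ M) (hw' : ∀ x, ‖w' x‖ ≤ M) (x : ℝ) :
    ‖cutErr χ₁ χ₂ m w w' x‖ ≤ 2 * C * M / m ^ 2 := by
  have hC : 0 ≤ C := (abs_nonneg _).trans (hχ.bound₁ 0)
  have hM : 0 ≤ M := (norm_nonneg _).trans (hw 0)
  have hm2 : 1 ≤ m ^ 2 := one_le_pow₀ hm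
  have hm0 : 0 < m ^ 2 := by positivity
  have a2 : |χ₂ (x / m ^ 2) / m ^ 2 / m ^ 2| ≤ C / m ^ 2 := by
    rw [abs_div, abs_div, abs_of_pos hm0]
    gcongr
    exact (div_le_self (abs_nonneg _) hm2).trans (hχ.bound₂ _)
  have a1 : |χ₁ (x / m ^ 2) / m ^ 2| ≤ C / m ^ 2 := by
    rw [abs_div, abs_of_pos hm0]
    gcongr
    exact hχ.bound₁ _
  have hCm : 0 ≤ C / m ^ 2 := by positivity
  rw [cutErr, norm_mul]
  have n0 : ‖(-(1 / 2) : ℂ)‖ = 1 / 2 := by norm_num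
  rw [n0]
  have n1 : ‖((χ₂ (x / m ^ 2) / m ^ 2 / m ^ 2 : ℝ) : ℂ) * w x +
      2 * (χ₁ (x / m ^ 2) / m ^ 2 : ℝ) * w' x‖ ≤ C / m ^ 2 * M + 2 * (C / m ^ 2) * M := by
    refine (norm_add_le _ _).trans (add_le_add ?_ ?_)
    · rw [norm_mul, Complex.norm_real, Real.norm_eq_abs]
      exact mul_le_mul a2 (hw x) (norm_nonneg _) hCm
    · rw [norm_mul, norm_mul, Complex.norm_real, Real.norm_eq_abs, Complex.norm_ofNat]
      exact mul_le_mul (by linarith) (hw' x) (norm_nonneg _) (by positivity)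
  have e : 2 * C * M / m ^ 2 = 2 * (C / m ^ 2 * M) := by ring
  rw [e]
  nlinarith [mul_nonneg hCm hM]

/-- The commutator is `O(m⁻²)` pointwise and lives on an interval of length `4m²`, so its `L²` norm
is `O(m⁻¹)`. The scale `m²` makes the square root of the length simply `2m`. -/
theorem IsCutoff.norm_toLp_cutErr_le (hχ : IsCutoff χ χ₁ χ₂ C) {m : ℝ} (hm : 1 ≤ m)
    (hw : ∀ x, ‖w x‖ ≤ M) (hw' : ∀ x, ‖w' x‖ ≤ M) (hL : MemLp (cutErr χ₁ χ₂ m w w') 2 volume) :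
    ‖hL.toLp _‖ ≤ 4 * C * M / m := by
  have hC : 0 ≤ C := (abs_nonneg _).trans (hχ.bound₁ 0)
  have hM : 0 ≤ M := (norm_nonneg _).trans (hw 0)
  have hm0 : 0 < m := by linarith
  have hvol : volume (Icc (-(2 * m ^ 2)) (2 * m ^ 2)) ≠ ∞ := by simp
  have key : ‖hL.toLp _‖ ≤ ‖indicatorConstLp 2 (measurableSet_Icc (a := -(2 * m ^ 2))
      (b := 2 * m ^ 2)) hvol ((2 * C * M / m ^ 2 : ℝ) : ℂ)‖ := by
    apply Lp.norm_le_norm_of_ae_le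
    filter_upwards [hL.coeFn_toLp, indicatorConstLp_coeFn (p := 2)
      (hs := measurableSet_Icc (a := -(2 * m ^ 2)) (b := 2 * m ^ 2)) (hμs := hvol)
      (c := ((2 * C * M / m ^ 2 : ℝ) : ℂ))] with x h1 h2
    rw [h1, h2]
    by_cases hx : x ∈ Icc (-(2 * m ^ 2)) (2 * m ^ 2)
    · rw [indicator_of_mem hx, Complex.norm_real, Real.norm_of_nonneg (by positivity)]
      exact hχ.norm_cutErr_le hm hw hw' x
    · rw [indicator_of_notMem hx]
      rw [mem_Icc, ← abs_le, not_le] at hx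
      simp [cutErr, (hχ.eq_zero _ (lt_abs_div hm hx)).2]
  refine key.trans (le_of_eq ?_)
  rw [norm_indicatorConstLp two_ne_zero ENNReal.ofNat_ne_top, Complex.norm_real,
    Real.norm_of_nonneg (by positivity), Real.volume_real_Icc_of_le (by nlinarith)]
  have e1 : 2 * m ^ 2 - -(2 * m ^ 2) = (2 * m) ^ 2 := by ring
  rw [e1, ENNReal.toReal_ofNat, ← Real.sqrt_eq_rpow, Real.sqrt_sq (by positivity)]
  field_simp
  ring

/-- The cut off solution is in the domain, up to the commutator error. -/
theorem IsCutoff.schrodingerGraph (hχ : IsCutoff χ χ₁ χ₂ C) {m : ℝ} (hm : 1 ≤ m) {q : ℝ → ℝ}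
    (hq : Continuous q) {μ : ℂ} {u : ℝ → ℂ} (hu : Continuous u) (hw : ∀ x, HasDerivAt w (w' x) x)
    (hw' : ∀ x, HasDerivAt w' (2 * (q x * w x - μ * u x)) x)
    (hL : MemLp (cutFun χ m w) 2 volume) (hLu : MemLp (cutFun χ m u) 2 volume)
    (hE : MemLp (cutErr χ₁ χ₂ m w w') 2 volume) :
    SchrodingerGraph q (hL.toLp _) (hE.toLp _ + μ • hLu.toLp _) := by
  have hwc : Continuous w := continuous_iff_continuousAt.2 fun x => (hw x).continuousAt
  have hwc' : Continuous w' := continuous_iff_continuousAt.2 fun x => (hw' x).continuousAt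
  have hχc : Continuous χ := continuous_iff_continuousAt.2 fun x => (hχ.deriv₁ x).continuousAt
  have hχc₁ : Continuous χ₁ := continuous_iff_continuousAt.2 fun x => (hχ.deriv₂ x).continuousAt
  have hχc₂ := hχ.continuous₂
  set f' : ℝ → ℂ := fun x => (χ₁ (x / m ^ 2) / m ^ 2 : ℝ) * w x + (χ (x / m ^ 2) : ℂ) * w' x
  set f'' : ℝ → ℂ := fun x => (χ₂ (x / m ^ 2) / m ^ 2 / m ^ 2 : ℝ) * w x +
    2 * (χ₁ (x / m ^ 2) / m ^ 2 : ℝ) * w' x +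
    (χ (x / m ^ 2) : ℂ) * (2 * (q x * w x - μ * u x)) with hf''
  have hscale : ∀ {g g' : ℝ → ℝ}, (∀ x, HasDerivAt g (g' x) x) →
      ∀ x, HasDerivAt (fun x => ((g (x / m ^ 2) : ℝ) : ℂ)) ((g' (x / m ^ 2) / m ^ 2 : ℝ) : ℂ) x := by
    intro g g' hg x
    have h1 : HasDerivAt (fun x : ℝ => x / m ^ 2) (1 / m ^ 2) x := (hasDerivAt_id x).div_const _
    have h2 := (hg (x / m ^ 2)).comp x h1
    exact (h2.congr_deriv (by ring)).ofReal_comp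
  have hd₁ : ∀ x, HasDerivAt (cutFun χ m w) (f' x) x := fun x =>
    (hscale hχ.deriv₁ x).mul (hw x)
  have hd₂ : ∀ x, HasDerivAt f' (f'' x) x := by
    intro x
    have h1 := hscale (g := fun y => χ₁ y / m ^ 2) (fun y => (hχ.deriv₂ y).div_const _) x
    exact ((h1.mul (hw x)).add ((hscale hχ.deriv₁ x).mul (hw' x))).congr_deriv (by
      simp only [hf'']; ring)
  have hf''c : Continuous f'' := by
    simp only [hf'']; fun_prop
  have hz : ∀ x, 2 * m ^ 2 < |x| → f'' x = 0 := by
    intro x hx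
    obtain ⟨a, b, c⟩ := hχ.eq_zero _ (lt_abs_div hm hx)
    simp [hf'', a, b, c]
  have hW : MemLp f'' 2 volume :=
    hf''c.memLp_of_hasCompactSupport (hasCompactSupport_of_eq_zero hz)
  have hcs : HasCompactSupport (cutFun χ m w) :=
    hasCompactSupport_of_eq_zero (m := m) fun x hx => by
      simp [cutFun, (hχ.eq_zero _ (lt_abs_div hm hx)).1]
  refine ⟨hW.toLp _, isWeakSecondDeriv_of_hasDerivAt hd₁ hd₂ hf''c hcs hL.coeFn_toLp
    hW.coeFn_toLp, ?_⟩
  filter_upwards [hW.coeFn_toLp, hL.coeFn_toLp, hLu.coeFn_toLp, hE.coeFn_toLp,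
    Lp.coeFn_add (hE.toLp _) (μ • hLu.toLp _), Lp.coeFn_smul μ (hLu.toLp _)] with x a b c d e f
  rw [e, Pi.add_apply, f, Pi.smul_apply, a, b, c, d, smul_eq_mul]
  simp only [hf'', cutErr, cutFun]
  ring

/-- A nonzero function stays away from zero in `L²` under the cutoffs. -/
theorem IsCutoff.exists_le_norm (hχ : IsCutoff χ χ₁ χ₂ C) (hw : Continuous w) {x₀ : ℝ}
    (h0 : w x₀ ≠ 0) : ∃ κ > 0, ∃ m₀ : ℝ, 1 ≤ m₀ ∧ ∀ m : ℝ, m₀ ≤ m →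
      ∀ hL : MemLp (cutFun χ m w) 2 volume, κ ≤ ‖hL.toLp _‖ := by
  have hpos : 0 < ‖w x₀‖ / 2 := by positivity
  have hev : ∀ᶠ x in 𝓝 x₀, ‖w x₀‖ / 2 < ‖w x‖ :=
    hw.norm.continuousAt.eventually_const_lt (by linarith)
  obtain ⟨r, hr, hball⟩ := Metric.eventually_nhds_iff.1 hev
  set s := Icc (x₀ - r / 2) (x₀ + r / 2) with hs
  have hvol : volume s ≠ ∞ := by simp [hs]
  set κ := ‖indicatorConstLp (E := ℂ) 2 (measurableSet_Icc (a := x₀ - r / 2) (b := x₀ + r / 2)) hvol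
    ((‖w x₀‖ / 2 : ℝ) : ℂ)‖ with hκ
  -- For such `m` the window around `x₀` lies in `|x| ≤ m²`, where the cutoff equals one.
  refine ⟨κ, ?_, |x₀| + r + 1, by linarith [abs_nonneg x₀], fun m hm hL => ?_⟩
  · rw [hκ, norm_indicatorConstLp two_ne_zero ENNReal.ofNat_ne_top, Complex.norm_real,
      Real.norm_of_nonneg hpos.le, Real.volume_real_Icc_of_le (by linarith)]
    have : 0 < x₀ + r / 2 - (x₀ - r / 2) := by linarith
    positivity
  · apply Lp.norm_le_norm_of_ae_le
    filter_upwards [hL.coeFn_toLp, indicatorConstLp_coeFn (p := 2)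
      (hs := measurableSet_Icc (a := x₀ - r / 2) (b := x₀ + r / 2)) (hμs := hvol)
      (c := ((‖w x₀‖ / 2 : ℝ) : ℂ))] with x h1 h2
    rw [h1, h2]
    by_cases hx : x ∈ s
    · rw [indicator_of_mem hx, Complex.norm_real, Real.norm_of_nonneg hpos.le]
      have hxr : |x - x₀| ≤ r / 2 := by
        rw [abs_le]; constructor <;> linarith [hx.1, hx.2]
      have hm1 : 1 ≤ m := by linarith [abs_nonneg x₀]
      have hxm : |x / m ^ 2| ≤ 1 := by
        have hm2 : 0 < m ^ 2 := by positivity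
        rw [abs_div, abs_of_pos hm2, div_le_one hm2]
        have h3 : |x| ≤ |x - x₀| + |x₀| := by simpa using abs_add_le (x - x₀) x₀
        nlinarith
      rw [cutFun, hχ.eq_one _ hxm, Complex.ofReal_one, one_mul]
      exact (hball (by rw [Real.dist_eq]; linarith)).le
    · rw [indicator_of_notMem hx, norm_zero]
      exact norm_nonneg _

end Weyl

/-! ### Imaginary points of the Bogoliubov spectrum. -/

/-- A bounded solution of `L₋ v = μ u`, `L₊ u = μ v` puts `μ` into the spectrum. -/
theorem mem_bogoliubovSpectrum_of_bounded {σ ω : ℝ} {V φ : ℝ → ℝ}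
    (hm : Continuous (minusPotential σ V ω φ)) (hp : Continuous (plusPotential σ V ω φ)) {μ : ℂ}
    {u u' v v' : ℝ → ℂ} (hu : ∀ x, HasDerivAt u (u' x) x) (hv : ∀ x, HasDerivAt v (v' x) x)
    (hu' : ∀ x, HasDerivAt u' (2 * (plusPotential σ V ω φ x * u x - μ * v x)) x)
    (hv' : ∀ x, HasDerivAt v' (2 * (minusPotential σ V ω φ x * v x - μ * u x)) x) {M : ℝ}
    (hM : ∀ x, ‖u x‖ ≤ M ∧ ‖u' x‖ ≤ M ∧ ‖v x‖ ≤ M ∧ ‖v' x‖ ≤ M)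
    (hn : ∃ x, u x ≠ 0 ∨ v x ≠ 0) : μ ∈ bogoliubovSpectrum σ V ω φ := by
  rintro ⟨R, hR⟩
  obtain ⟨χ, χ₁, χ₂, C, hχ⟩ := exists_isCutoff
  have hC : 0 ≤ C := (abs_nonneg _).trans (hχ.bound₁ 0)
  have hM0 : 0 ≤ M := (norm_nonneg _).trans (hM 0).1
  have huc : Continuous u := continuous_iff_continuousAt.2 fun x => (hu x).continuousAt
  have hvc : Continuous v := continuous_iff_continuousAt.2 fun x => (hv x).continuousAt
  have huc' : Continuous u' := continuous_iff_continuousAt.2 fun x => (hu' x).continuousAt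
  have hvc' : Continuous v' := continuous_iff_continuousAt.2 fun x => (hv' x).continuousAt
  -- Both components carry the same cutoff, so the terms with `μ` cancel and `B - μ` maps the pair
  -- to the commutator errors alone. A bounded inverse would force the pair to be `O(1/m)`.
  have hupper : ∀ (m : ℝ) (hm1 : 1 ≤ m), ‖(((hχ.memLp_cutFun hm1 huc).toLp _ : L2),
      ((hχ.memLp_cutFun hm1 hvc).toLp _ : L2))‖ ≤ ‖R‖ * (4 * C * M / m) := by
    intro m hm1
    have hU := (hR ((hχ.memLp_cutFun hm1 huc).toLp _, (hχ.memLp_cutFun hm1 hvc).toLp _)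
      ((hχ.memLp_cutErr hm1 hvc hvc').toLp _, (hχ.memLp_cutErr hm1 huc huc').toLp _)).1
      ⟨hχ.schrodingerGraph hm1 hm huc hv hv' (hχ.memLp_cutFun hm1 hvc)
          (hχ.memLp_cutFun hm1 huc) (hχ.memLp_cutErr hm1 hvc hvc'),
        hχ.schrodingerGraph hm1 hp hvc hu hu' (hχ.memLp_cutFun hm1 huc)
          (hχ.memLp_cutFun hm1 hvc) (hχ.memLp_cutErr hm1 huc huc')⟩
    rw [hU]
    refine (R.le_opNorm _).trans (mul_le_mul_of_nonneg_left ?_ (norm_nonneg _))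
    exact max_le (hχ.norm_toLp_cutErr_le hm1 (fun x => (hM x).2.2.1) (fun x => (hM x).2.2.2)
      (hχ.memLp_cutErr hm1 hvc hvc'))
      (hχ.norm_toLp_cutErr_le hm1 (fun x => (hM x).1) (fun x => (hM x).2.1)
      (hχ.memLp_cutErr hm1 huc huc'))
  obtain ⟨κ, hκ, m₀, hm₀, hlower⟩ : ∃ κ > 0, ∃ m₀ : ℝ, 1 ≤ m₀ ∧ ∀ m : ℝ, ∀ hm1 : 1 ≤ m, m₀ ≤ m →
      κ ≤ ‖(((hχ.memLp_cutFun hm1 huc).toLp _ : L2),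
        ((hχ.memLp_cutFun hm1 hvc).toLp _ : L2))‖ := by
    obtain ⟨x₀, h0 | h0⟩ := hn
    · obtain ⟨κ, hκ, m₀, hm₀, H⟩ := hχ.exists_le_norm huc h0
      exact ⟨κ, hκ, m₀, hm₀, fun m hm1 hmm => (H m hmm (hχ.memLp_cutFun hm1 huc)).trans
        (le_max_left _ _)⟩
    · obtain ⟨κ, hκ, m₀, hm₀, H⟩ := hχ.exists_le_norm hvc h0
      exact ⟨κ, hκ, m₀, hm₀, fun m hm1 hmm => (H m hmm (hχ.memLp_cutFun hm1 hvc)).trans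
        (le_max_right _ _)⟩
  set A := ‖R‖ * (4 * C * M) with hA
  have hA0 : 0 ≤ A := by positivity
  -- This makes `κ m ≥ A + 1`, whereas the two bounds give `κ m ≤ A`.
  set m := m₀ + (A + 1) / κ with hmdef
  have hmm : m₀ ≤ m := by
    have : 0 ≤ (A + 1) / κ := by positivity
    linarith
  have hm1 : 1 ≤ m := hm₀.trans hmm
  have h1 := (hlower m hm1 hmm).trans (hupper m hm1)
  have h2 : ‖R‖ * (4 * C * M / m) = A / m := by rw [hA]; ring
  rw [h2, le_div_iff₀ (by linarith)] at h1
  have h3 : κ * m = κ * m₀ + (A + 1) := by rw [hmdef]; field_simp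
  nlinarith

/-- If zero is in the interior of a band of `L₊`, then the Bogoliubov spectrum contains a segment of
the imaginary axis. -/
theorem IsStandingWave.hasImaginaryBand {σ ω : ℝ} {V φ : ℝ → ℝ} (h : IsStandingWave σ V ω φ)
    (hV : Continuous V) (hVp : ∀ x, V (x + 1) = V x)
    (hb : InBandInterior (plusPotential σ V ω φ) 0) : HasImaginaryBand σ V ω φ := by
  have hmc := continuous_minusPotential (σ := σ) (ω := ω) hV h.contDiff.continuous
  have hpc := continuous_plusPotential (σ := σ) (ω := ω) hV h.contDiff.continuous
  have hmp := h.minusPotential_periodic hVp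
  have hpp := h.plusPotential_periodic hVp
  obtain ⟨ψ, φ₂, ψ₂, ε, c, hpar⟩ := h.exists_isParabolic hV hVp
  have hQ₁ : Continuous fun x => 2 * (minusPotential σ V ω φ x - 0) := by fun_prop
  have hQ₂ : Continuous fun x => 2 * (plusPotential σ V ω φ x - 0) := by fun_prop
  have hQp₁ : ∀ x, 2 * (minusPotential σ V ω φ (x + 1) - 0) =
      2 * (minusPotential σ V ω φ x - 0) := fun x => by rw [hmp]
  have hQp₂ : ∀ x, 2 * (plusPotential σ V ω φ (x + 1) - 0) =
      2 * (plusPotential σ V ω φ x - 0) := fun x => by rw [hpp]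
  obtain ⟨c₁, c₁', s₁, s₁', hf₁⟩ := exists_isFund hQ₁ hQp₁
  obtain ⟨c₂, c₂', s₂, s₂', hf₂, hT₂⟩ := (inBandInterior_iff hpc).1 hb
  have hT₁ : |c₁ 1 + s₁' 1| = 2 := by
    have hε : |ε| = 1 := by
      rw [← sq_eq_sq₀ (abs_nonneg _) one_pos.le, sq_abs, one_pow, hpar.sq_eq_one]
    rw [hpar.trace_eq hQ₁ hQp₁ hf₁, abs_mul, hε]
    norm_num
  obtain ⟨τ₀, hτ₀, H⟩ := exists_isBoundedCoupledSol hQ₁ hQ₂ hQp₁ hQp₂ hf₁ hf₂ hT₁ hT₂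
  -- The factor `2` in `Q = 2q` turns `μ = iτ` into the coupling `t = 2τ`.
  refine ⟨τ₀ / 2, by positivity, fun τ hτ => ?_⟩
  obtain ⟨v, v', p, p', hs⟩ := H (2 * τ) (by rw [abs_mul, abs_two]; linarith)
  obtain ⟨M, hM⟩ := hs.bounded
  refine mem_bogoliubovSpectrum_of_bounded hmc hpc (u := fun x => Complex.I * p x)
    (u' := fun x => Complex.I * p' x) (v := v) (v' := v') (M := M)
    (fun x => (hs.deriv_p x).const_mul _) hs.deriv_v (fun x => ?_) (fun x => ?_) (fun x => ?_) ?_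
  · exact ((hs.deriv_p' x).const_mul _).congr_deriv (by push_cast; ring)
  · refine (hs.deriv_v' x).congr_deriv ?_
    push_cast
    linear_combination (2 * (τ : ℂ) * p x) * Complex.I_mul_I
  · obtain ⟨a, b, c, d⟩ := hM x
    simpa using ⟨c, d, a, b⟩
  · obtain ⟨x, hx | hx⟩ := hs.nontrivial
    · exact ⟨x, Or.inr hx⟩
    · exact ⟨x, Or.inl (mul_ne_zero Complex.I_ne_zero hx)⟩

theorem HasImaginaryBand.modulationallyUnstable {σ ω : ℝ} {V φ : ℝ → ℝ}
    (h : HasImaginaryBand σ V ω φ) : ModulationallyUnstable σ V ω φ := by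
  obtain ⟨τ₀, hτ₀, H⟩ := h
  intro ε hε
  have hpos : 0 < min τ₀ ε / 2 := by positivity
  refine ⟨Complex.I * (min τ₀ ε / 2 : ℝ), H _ ?_, ?_, ?_⟩
  · rw [abs_of_pos hpos]; linarith [min_le_left τ₀ ε]
  · rw [norm_mul, Complex.norm_I, one_mul, Complex.norm_real, Real.norm_of_nonneg hpos.le]
    linarith [min_le_right τ₀ ε]
  · rw [Complex.I_mul_im, Complex.ofReal_re]
    exact hpos.ne'

theorem IsStandingWave.unstable {σ ω : ℝ} {V φ : ℝ → ℝ} (h : IsStandingWave σ V ω φ)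
    (hV : Continuous V) (hVp : ∀ x, V (x + 1) = V x)
    (hb : InBandInterior (plusPotential σ V ω φ) 0) :
    ModulationallyUnstable σ V ω φ ∧ HasImaginaryBand σ V ω φ :=
  ⟨(h.hasImaginaryBand hV hVp hb).modulationallyUnstable, h.hasImaginaryBand hV hVp hb⟩

end GP

theorem mainTheorem2 :
    (∀ K : ℝ, ∃ δ > 0, ∀ V : ℝ → ℝ, Continuous V → (∀ x, V (x + 1) = V x) → (∀ x, |V x| ≤ K) →
      ∀ (ω : ℝ) (φ : ℝ → ℝ), (∀ x, |φ x| < δ) →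
        (GP.IsStandingWave (-1) V ω φ →
          GP.IsLowerBandEdge (GP.minusPotential (-1) V ω φ) 0 →
          GP.ModulationallyUnstable (-1) V ω φ ∧ GP.HasImaginaryBand (-1) V ω φ) ∧
        (GP.IsStandingWave 1 V ω φ →
          GP.IsUpperBandEdge (GP.minusPotential 1 V ω φ) 0 →
          GP.ModulationallyUnstable 1 V ω φ ∧ GP.HasImaginaryBand 1 V ω φ)) ∧
    (∀ V : ℝ → ℝ, Continuous V → (∀ x, V (x + 1) = V x) → ∀ E : ℝ,
      (GP.IsLowerBandEdgeAtGap V E →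
        ∃ δ > 0, ∀ (ω : ℝ) (φ : ℝ → ℝ), |ω - E| < δ → (∀ x, |φ x| < δ) →
          GP.IsStandingWave (-1) V ω φ →
          GP.ModulationallyUnstable (-1) V ω φ ∧ GP.HasImaginaryBand (-1) V ω φ) ∧
      (GP.IsUpperBandEdgeAtGap V E →
        ∃ δ > 0, ∀ (ω : ℝ) (φ : ℝ → ℝ), |ω - E| < δ → (∀ x, |φ x| < δ) →
          GP.IsStandingWave 1 V ω φ →
          GP.ModulationallyUnstable 1 V ω φ ∧ GP.HasImaginaryBand 1 V ω φ)) := by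
  refine ⟨fun K => ?_, fun V hV hVp E => ⟨fun hE => ?_, fun hE => ?_⟩⟩
  · obtain ⟨δ, hδ, H⟩ := GP.exists_inBandInterior_of_edge K
    refine ⟨δ, hδ, fun V hV hVp hK ω φ hφ => ⟨fun hw hedge => ?_, fun hw hedge => ?_⟩⟩
    · exact hw.unstable hV hVp ((H V hV hVp hK ω φ hφ).1 hw hedge)
    · exact hw.unstable hV hVp ((H V hV hVp hK ω φ hφ).2 hw hedge)
  · obtain ⟨δ, hδ, H⟩ := hE.exists_inBandInterior hV hVp
    exact ⟨δ, hδ, fun ω φ hω hφ hw => hw.unstable hV hVp (H ω φ hω hφ hw)⟩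
  · obtain ⟨δ, hδ, H⟩ := hE.exists_inBandInterior hV hVp
    exact ⟨δ, hδ, fun ω φ hω hφ hw => hw.unstable hV hVp (H ω φ hω hφ hw)⟩
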